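/- **Conventions.** A *W-semigroup* is an abelian monoid $S$ with a transitive relation $\prec$ such that $0\prec a$ for all $a$; $a'\prec a$ and $b'\prec b$ imply $a'+b'\prec a+b$; every $a$ admits a sequence $a_0\prec a_1\prec\cdots$ with $a_k\prec a$ for all $k$ and such that each $b\prec a$ satisfies $b\prec a_k$ for some $k$; and $a\prec b+c$ implies $a\prec b'+c'$ for some $b'\prec b$, $c'\prec c$. A *W-morphism* is an additive map $f$ (with $f(0)=0$) that preserves $\prec$ and is such that $b\prec f(a)$ implies $b\prec f(a')$ for some $a'\prec a$. A *closed ideal* of $S$ is a submonoid $J$ such that $a\prec b\in J$ implies $a\in J$, and such that $a\in J$ whenever $\{b: b\prec a\}\subseteq J$. For an additive preorder $\le$ on $S$, the quotient of $S$ by $\le$ is its antisymmetrization with the induced sum and order, and with $x\prec[b]$ iff $x\le [a]$ and $a\prec b'$ for some $a,b'$ with $[b']=[b]$. The quotient $S/J$ is taken with respect to: $a\le_J b$ iff for every $x\prec a$ there is $y\in J$ with $x\prec b+y$. If a group $G$ acts on $S$, then $S/G$ is the quotient by $\le_G$, the smallest preorder on $S$ such that $a\le b$ holds whenever (i) $\{c:c\prec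 a\}\subseteq\{c:c\prec b\}$, or (ii) $a=gb$ for some $g\in G$, or (iii) $c\le b$ for all $c\prec a$, or (iv) $a=a_1+a_2$, $b=b_1+b_2$ with $a_k\le b_k$. The completion $\gamma(S)$ consists of the sequences $(s_n)$ in $S$ with $s_n\prec s_{n+1}$, added termwise and preordered by $(s_n)\le(t_n)$ iff for every $n$ there is $m$ with $s_n\prec t_m$, modulo the induced equivalence. A *Cu-semigroup* is a positively ordered monoid in which increasing sequences have suprema, every element is the supremum of a $\ll$-increasing sequence, $\ll$ is additive, and suprema of increasing sequences are additive; here $a\ll b$ means that for every increasing sequence $(b_n)$ whose supremum exists and satisfies $b\le\sup_n b_n$ there is $n$ with $a\le b_n$. An *ideal* of it is a submonoid $K$ that is order-hereditary and closed under suprema of increasing sequences; the quotient by $K$ is the antisymmetrization of: $a\le_K b$ iff $a\le b+z$ for some $z\in K$. For a C*-algebra $A$, $\mathrm W(A)$ is the set of positive square matrices of all sizes over $A$ modulo Cuntz equivalence ($a\precsim b$ iff for every $\varepsilon>0$ there is a rectangular matrix $x$ over $A$ with $\|a-xbx^*\|<\varepsilon$; $a\sim b$ iff $a\precsim b\precsim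 a$), with $[a]+[b]=[a\oplus b]$ and $[a]\prec[b]$ iff $a\precsim(b-\delta)_+$ for some $\delta>0$. If a group $G$ acts on $A$ by $*$-automorphisms, then $G$ acts on $\mathrm W(A)$ by $g[a]=[ga]$, and $\mathrm W_G(A)=\mathrm W(A)/G$, $\mathrm{Cu}_G(A)=\gamma(\mathrm W_G(A))$. **Theorem.** Let a discrete group $G$ act on a C*-algebra $A$ (not necessarily unital) by $*$-automorphisms, let $I$ be a $G$-invariant closed two-sided ideal of $A$, and let $G$ act on $I$ and $A/I$ by restriction and passage to the quotient. Then $\mathrm W_G(A)$, $\mathrm W_G(I)$, $\mathrm W_G(A/I)$ are W-semigroups and $\mathrm{Cu}_G(A)$, $\mathrm{Cu}_G(I)$, $\mathrm{Cu}_G(A/I)$ are Cu-semigroups. The inclusion $I\to A$ and the quotient map $A\to A/I$ induce W-morphisms $i\colon \mathrm W_G(I)\to\mathrm W_G(A)$, $[x]\mapsto[x]$, and $p\colon\mathrm W_G(A)\to\mathrm W_G(A/I)$, and: 1. $i$ preserves and reflects both $\le$ and $\prec$, and its image is a closed ideal of $\mathrm W_G(A)$; thus $\mathrm W_G(I)$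 is isomorphic to an ideal of $\mathrm W_G(A)$. 2. $p$ induces an isomorphism of W-semigroups (and of ordered monoids) $\mathrm W_G(A)/\mathrm W_G(I)\cong \mathrm W_G(A/I)$. 3. The map $j\colon\mathrm{Cu}_G(I)\to\mathrm{Cu}_G(A)$, $[(s_n)]\mapsto[(i(s_n))]$, is a well-defined additive map that preserves and reflects $\le$, and its image is an ideal of $\mathrm{Cu}_G(A)$; thus $\mathrm{Cu}_G(I)$ is isomorphic to an ideal of $\mathrm{Cu}_G(A)$. 4. The assignment $[(s_n)]\mapsto[(p(s_n))]$ induces an isomorphism of ordered monoids, hence of Cu-semigroups, $\mathrm{Cu}_G(A)/\mathrm{Cu}_G(I)\cong\mathrm{Cu}_G(A/I)$. -/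

import Mathlib

namespace DynCuntz

set_option linter.unusedSectionVars false

/-! ### Ideals, quotients and actions on C*-algebras -/

attribute [local instance] CStarAlgebra.spectralOrder CStarAlgebra.spectralOrderedRing

/-- A closed two-sided ideal of a C*-algebra. -/
structure ClosedIdeal (A : Type*) [NonUnitalCStarAlgebra A] extends Submodule ℂ A where
  mul_mem_left' : ∀ a x : A, x ∈ carrier → a * x ∈ carrier
  mul_mem_right' : ∀ a x : A, x ∈ carrier → x * a ∈ carrier
  isClosed' : IsClosed carrier

namespace ClosedIdeal

variable {A : Type*} [NonUnitalCStarAlgebra A]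

instance : SetLike (ClosedIdeal A) A where
  coe I := I.carrier
  coe_injective := by
    rintro ⟨I, _⟩ ⟨J, _⟩ h
    congr
    exact SetLike.coe_injective h

theorem norm_sub_mul_cfc_sq_le {y : A} {f : ℝ → ℝ} (hf : Continuous f) (hf0 : f 0 = 0) {c : ℝ}
    (hc : ∀ t, 0 ≤ t → |t * (1 - f t) * (1 - f t)| ≤ c) :
    ‖y - y * cfcₙ f (star y * y)‖ ^ 2 ≤ c := by
  set h : A := star y * y with hh
  have hh0 : 0 ≤ h := star_mul_self_nonneg y
  have hsa : IsSelfAdjoint h := .of_nonneg hh0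
  have husa : star (cfcₙ f h) = cfcₙ f h := cfcₙ_predicate f h
  have hid : cfcₙ (fun t : ℝ => t) h = h := cfcₙ_id' ℝ h
  have m1 : cfcₙ (fun t : ℝ => t * f t) h = h * cfcₙ f h := by
    rw [cfcₙ_mul (fun t : ℝ => t) f h continuousOn_id rfl hf.continuousOn hf0, hid]
  have m2 : cfcₙ (fun t : ℝ => f t * (t - t * f t)) h = cfcₙ f h * (h - h * cfcₙ f h) := by
    rw [cfcₙ_mul f (fun t : ℝ => t - t * f t) h hf.continuousOn hf0
      (by fun_prop) (by simp), cfcₙ_sub (fun t : ℝ => t) (fun t => t * f t) h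
      continuousOn_id rfl (by fun_prop) (by simp), hid, m1]
  have e2 : star (y - y * cfcₙ f h) * (y - y * cfcₙ f h) =
      cfcₙ (fun t : ℝ => (t - t * f t) - f t * (t - t * f t)) h := by
    rw [cfcₙ_sub (fun t : ℝ => t - t * f t) (fun t => f t * (t - t * f t)) h
        (by fun_prop) (by simp) (by fun_prop) (by simp), m2,
      cfcₙ_sub (fun t : ℝ => t) (fun t => t * f t) h
      continuousOn_id rfl (by fun_prop) (by simp), hid, m1]
    rw [star_sub, star_mul, husa, hh]
    noncomm_ring
  rw [sq, ← CStarRing.norm_star_mul_self, e2]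
  refine norm_cfcₙ_le fun t ht => ?_
  have ht0 : 0 ≤ t := quasispectrum_nonneg_of_nonneg h hh0 t ht
  have : t - t * f t - f t * (t - t * f t) = t * (1 - f t) * (1 - f t) := by ring
  rw [this]
  exact hc t ht0

theorem norm_sub_mul_cfc_le {h : A} (hsa : IsSelfAdjoint h) {f : ℝ → ℝ} (hf : Continuous f)
    (hf0 : f 0 = 0) (hf1 : ∀ t, |1 - f t| ≤ 1) (a : A) : ‖a - a * cfcₙ f h‖ ≤ ‖a‖ := by
  have hsa' : IsSelfAdjoint (h : Unitization ℂ A) := hsa.inr ℂ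
  have k1 : ((a - a * cfcₙ f h : A) : Unitization ℂ A) =
      (a : Unitization ℂ A) * cfc (fun t : ℝ => 1 - f t) (h : Unitization ℂ A) := by
    rw [cfc_sub (fun _ : ℝ => 1) f (h : Unitization ℂ A) continuousOn_const hf.continuousOn,
      cfc_const_one ℝ (h : Unitization ℂ A), ← Unitization.real_cfcₙ_eq_cfc_inr h f hf0]
    simp [mul_sub]
  rw [← Unitization.norm_inr (𝕜 := ℂ), k1]
  refine (norm_mul_le _ _).trans ?_
  rw [Unitization.norm_inr]
  exact mul_le_of_le_one_right (norm_nonneg _) (norm_cfc_le zero_le_one fun t _ => hf1 t)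

theorem exists_unit (I : ClosedIdeal A) (y : A) (hy : star y * y ∈ I) (ε : ℝ) (hε : 0 < ε) :
    ∃ u ∈ I, ‖y - y * u‖ < ε ∧ ∀ a : A, ‖a - a * u‖ ≤ ‖a‖ := by
  have hsa : IsSelfAdjoint (star y * y) := .of_nonneg (star_mul_self_nonneg y)
  obtain ⟨δ, hδ, hδε⟩ : ∃ δ : ℝ, 0 < δ ∧ δ = ε ^ 2 * ε ^ 2 := ⟨_, by positivity, rfl⟩
  have hpos : ∀ t : ℝ, 0 < t ^ 2 + δ := fun t => by positivity
  obtain ⟨g, hg, hg0, hgt⟩ : ∃ g : ℝ → ℝ, Continuous g ∧ g 0 = 0 ∧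
      ∀ t, 1 - t * g t = δ / (t ^ 2 + δ) := by
    refine ⟨fun t => t / (t ^ 2 + δ), continuous_id.div (by fun_prop) fun t => (hpos t).ne',
      by simp, fun t => ?_⟩
    have := (hpos t).ne'
    field_simp
    ring
  have hf1 : ∀ t, 0 ≤ 1 - t * g t ∧ 1 - t * g t ≤ 1 := fun t => by
    rw [hgt]
    refine ⟨(div_pos hδ (hpos t)).le, ?_⟩
    rw [div_le_one (hpos t)]
    nlinarith [sq_nonneg t]
  have hf : Continuous fun t : ℝ => t * g t := continuous_id.mul hg
  refine ⟨cfcₙ (fun t : ℝ => t * g t) (star y * y), ?_, ?_, ?_⟩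
  · rw [cfcₙ_mul (fun t : ℝ => t) g (star y * y) continuousOn_id rfl hg.continuousOn hg0,
      cfcₙ_id' ℝ (star y * y)]
    exact I.mul_mem_right' _ _ hy
  · have e3 : ‖y - y * cfcₙ (fun t : ℝ => t * g t) (star y * y)‖ ^ 2 ≤ ε ^ 2 / 2 := by
      refine norm_sub_mul_cfc_sq_le hf (by simp) fun t ht0 => ?_
      rw [abs_of_nonneg (mul_nonneg (mul_nonneg ht0 (hf1 t).1) (hf1 t).1)]
      refine (mul_le_of_le_one_right (mul_nonneg ht0 (hf1 t).1) (hf1 t).2).trans ?_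
      rw [hgt, ← mul_div_assoc, div_le_div_iff₀ (hpos t) two_pos]
      rw [hδε]
      nlinarith [mul_nonneg (sq_nonneg ε) (sq_nonneg (t - ε ^ 2))]
    have : ‖y - y * cfcₙ (fun t : ℝ => t * g t) (star y * y)‖ ^ 2 < ε ^ 2 := by
      have : 0 < ε ^ 2 := by positivity
      linarith
    exact lt_of_pow_lt_pow_left₀ 2 hε.le this
  · exact norm_sub_mul_cfc_le hsa hf (by simp) fun t => by
      rw [abs_of_nonneg (hf1 t).1]
      exact (hf1 t).2

theorem star_mem (I : ClosedIdeal A) {x : A} (hx : x ∈ I) : star x ∈ I := by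
  have : star x ∈ closure (I : Set A) := by
    rw [Metric.mem_closure_iff]
    intro ε hε
    obtain ⟨u, hu, h1, -⟩ := I.exists_unit (star x)
      (by rw [star_star]; exact I.mul_mem_right' _ _ hx) ε hε
    exact ⟨star x * u, I.mul_mem_left' _ _ hu, by rwa [dist_eq_norm]⟩
  exact (I.isClosed'.closure_eq ▸ this : star x ∈ (I.carrier : Set A))

/-- A closed two-sided ideal as a C*-subalgebra. -/
def toStarSubalgebra (I : ClosedIdeal A) : NonUnitalStarSubalgebra ℂ A where
  carrier := I.carrier
  add_mem' := I.add_mem'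
  zero_mem' := I.zero_mem'
  mul_mem' := fun {_ _} _ hb => I.mul_mem_left' _ _ hb
  smul_mem' := I.smul_mem'
  star_mem' := fun ha => I.star_mem ha

instance (I : ClosedIdeal A) : IsClosed (I.toStarSubalgebra : Set A) := I.isClosed'

instance (I : ClosedIdeal A) : IsClosed (I.toSubmodule : Set A) := I.isClosed'

/-- The inclusion of the ideal. -/
def incl (I : ClosedIdeal A) : I.toStarSubalgebra →⋆ₙₐ[ℂ] A :=
  NonUnitalStarSubalgebraClass.subtype I.toStarSubalgebra

/-- The quotient C*-algebra `A / I`, with the quotient norm. -/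
def Quot (I : ClosedIdeal A) : Type _ := A ⧸ I.toSubmodule

noncomputable instance (I : ClosedIdeal A) : NormedAddCommGroup I.Quot :=
  inferInstanceAs (NormedAddCommGroup (A ⧸ I.toSubmodule))

instance (I : ClosedIdeal A) : CompleteSpace I.Quot :=
  inferInstanceAs (CompleteSpace (A ⧸ I.toSubmodule))

noncomputable instance (I : ClosedIdeal A) : NormedSpace ℂ I.Quot :=
  inferInstanceAs (NormedSpace ℂ (A ⧸ I.toSubmodule))

/-- The class in `A / I` of an element of `A`. -/
def qmk (I : ClosedIdeal A) : A →ₗ[ℂ] I.Quot := I.toSubmodule.mkQ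

variable {I : ClosedIdeal A}

theorem mk_surjective : Function.Surjective I.qmk := I.toSubmodule.mkQ_surjective

theorem mk_eq_mk {a b : A} : I.qmk a = I.qmk b ↔ a - b ∈ I := Submodule.Quotient.eq _

theorem norm_mk_le (a : A) : ‖I.qmk a‖ ≤ ‖a‖ := Submodule.Quotient.norm_mk_le _ a

theorem exists_norm_lt (x : I.Quot) {ε : ℝ} (hε : 0 < ε) : ∃ a, I.qmk a = x ∧ ‖a‖ < ‖x‖ + ε :=
  Submodule.Quotient.norm_mk_lt (S := I.toSubmodule) x hε

instance : Mul I.Quot where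
  mul := Quotient.map₂ (· * ·) fun a b h c d h' => by
    have h1 : a - b ∈ I := Submodule.quotientRel_def _ |>.1 h
    have h2 : c - d ∈ I := Submodule.quotientRel_def _ |>.1 h'
    refine (Submodule.quotientRel_def _).2 ?_
    have : a * c - b * d = (a - b) * c + b * (c - d) := by noncomm_ring
    change a * c - b * d ∈ I.toSubmodule
    rw [this]
    exact I.toSubmodule.add_mem (I.mul_mem_right' _ _ h1) (I.mul_mem_left' _ _ h2)

instance : Star I.Quot where
  star := Quotient.map star fun a b h => by
    have h1 : a - b ∈ I := Submodule.quotientRel_def _ |>.1 h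
    refine (Submodule.quotientRel_def _).2 ?_
    rw [← star_sub]
    exact I.star_mem h1

theorem mk_mul (a b : A) : I.qmk (a * b) = I.qmk a * I.qmk b := rfl

theorem mk_star (a : A) : I.qmk (star a) = star (I.qmk a) := rfl

theorem mk_add (a b : A) : I.qmk (a + b) = I.qmk a + I.qmk b := rfl

theorem quot_norm_mul_le (x y : I.Quot) : ‖x * y‖ ≤ ‖x‖ * ‖y‖ := by
  have key : ∀ ε > 0, ‖x * y‖ ≤ (‖x‖ + ε) * (‖y‖ + ε) := fun ε hε => by
    obtain ⟨a, rfl, ha⟩ := exists_norm_lt x hε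
    obtain ⟨b, rfl, hb⟩ := exists_norm_lt y hε
    rw [← mk_mul]
    refine (norm_mk_le _).trans ((norm_mul_le _ _).trans ?_)
    gcongr
  have hc : Filter.Tendsto (fun ε : ℝ => (‖x‖ + ε) * (‖y‖ + ε)) (nhdsWithin 0 (Set.Ioi 0))
      (nhds ((‖x‖ + 0) * (‖y‖ + 0))) :=
    ((by fun_prop : Continuous fun ε : ℝ => (‖x‖ + ε) * (‖y‖ + ε)).tendsto 0).mono_left
      nhdsWithin_le_nhds
  simp only [add_zero] at hc
  exact ge_of_tendsto hc (Filter.eventually_of_mem self_mem_nhdsWithin key)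

theorem quot_norm_mul_self_le (x : I.Quot) : ‖x‖ * ‖x‖ ≤ ‖star x * x‖ := by
  refine le_of_forall_pos_le_add fun ε hε => ?_
  obtain ⟨a, rfl⟩ := mk_surjective x
  obtain ⟨b, hb, hbn⟩ := exists_norm_lt (star (I.qmk a) * I.qmk a) (half_pos hε)
  rw [← mk_star, ← mk_mul, mk_eq_mk] at hb
  set z := star a * a - b with hz
  have hzI : z ∈ I := by
    have := I.toSubmodule.neg_mem hb
    rwa [neg_sub] at this
  obtain ⟨u, hu, hu1, hu2⟩ := I.exists_unit z (I.mul_mem_left' _ _ hzI) (ε / 2) (half_pos hε)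
  have e1 : I.qmk a = I.qmk (a - a * u) := by
    rw [mk_eq_mk, sub_sub_cancel]
    exact I.mul_mem_left' _ _ hu
  have e2 : star (a - a * u) * (a - a * u) =
      star (star (star a * a - star a * a * u) - star (star a * a - star a * a * u) * u) := by
    simp only [star_sub, star_mul, star_star]
    noncomm_ring
  have e3 : star a * a - star a * a * u = (z - z * u) + (b - b * u) := by
    rw [hz]; noncomm_ring
  calc ‖I.qmk a‖ * ‖I.qmk a‖ ≤ ‖a - a * u‖ * ‖a - a * u‖ := by
        rw [e1]
        have := norm_mk_le (I := I) (a - a * u)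
        gcongr
    _ = ‖star (a - a * u) * (a - a * u)‖ := CStarRing.norm_star_mul_self.symm
    _ ≤ ‖star a * a - star a * a * u‖ := by
        rw [e2, norm_star]
        exact (hu2 _).trans (norm_star _).le
    _ ≤ ‖z - z * u‖ + ‖b - b * u‖ := by
        rw [e3]
        exact norm_add_le _ _
    _ ≤ ‖star (I.qmk a) * I.qmk a‖ + ε := by
        linarith [hu2 b]

noncomputable instance (I : ClosedIdeal A) : NonUnitalCStarAlgebra I.Quot where
  __ := (inferInstance : NormedAddCommGroup I.Quot)
  __ := (inferInstance : NormedSpace ℂ I.Quot)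
  complete := CompleteSpace.complete
  left_distrib := by
    intro x y z
    obtain ⟨a, rfl⟩ := mk_surjective x
    obtain ⟨b, rfl⟩ := mk_surjective y
    obtain ⟨c, rfl⟩ := mk_surjective z
    simp only [← mk_mul, ← mk_add, mul_add]
  right_distrib := by
    intro x y z
    obtain ⟨a, rfl⟩ := mk_surjective x
    obtain ⟨b, rfl⟩ := mk_surjective y
    obtain ⟨c, rfl⟩ := mk_surjective z
    simp only [← mk_mul, ← mk_add, add_mul]
  zero_mul := by
    intro x
    obtain ⟨a, rfl⟩ := mk_surjective x
    rw [← map_zero I.qmk, ← mk_mul, zero_mul]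
  mul_zero := by
    intro x
    obtain ⟨a, rfl⟩ := mk_surjective x
    rw [← map_zero I.qmk, ← mk_mul, mul_zero]
  mul_assoc := by
    intro x y z
    obtain ⟨a, rfl⟩ := mk_surjective x
    obtain ⟨b, rfl⟩ := mk_surjective y
    obtain ⟨c, rfl⟩ := mk_surjective z
    simp only [← mk_mul, mul_assoc]
  dist_eq := dist_eq_norm_neg_add
  norm_mul_le := quot_norm_mul_le
  star_involutive := by
    intro x
    obtain ⟨a, rfl⟩ := mk_surjective x
    rw [← mk_star, ← mk_star, star_star]
  star_mul := by
    intro x y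
    obtain ⟨a, rfl⟩ := mk_surjective x
    obtain ⟨b, rfl⟩ := mk_surjective y
    simp only [← mk_mul, ← mk_star, star_mul]
  star_add := by
    intro x y
    obtain ⟨a, rfl⟩ := mk_surjective x
    obtain ⟨b, rfl⟩ := mk_surjective y
    simp only [← mk_add, ← mk_star, star_add]
  norm_mul_self_le := quot_norm_mul_self_le
  smul_assoc := by
    intro c x y
    obtain ⟨a, rfl⟩ := mk_surjective x
    obtain ⟨b, rfl⟩ := mk_surjective y
    simp only [smul_eq_mul, ← map_smul, ← mk_mul, smul_mul_assoc]
  smul_comm := by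
    intro c x y
    obtain ⟨a, rfl⟩ := mk_surjective x
    obtain ⟨b, rfl⟩ := mk_surjective y
    simp only [smul_eq_mul, ← map_smul, ← mk_mul, mul_smul_comm]
  star_smul := by
    intro c x
    obtain ⟨a, rfl⟩ := mk_surjective x
    simp only [← map_smul, ← mk_star, star_smul]

/-- The quotient map `A → A / I`. -/
noncomputable def proj (I : ClosedIdeal A) : A →⋆ₙₐ[ℂ] I.Quot where
  toFun := I.qmk
  map_smul' := map_smul I.qmk
  map_zero' := map_zero I.qmk
  map_add' := map_add I.qmk
  map_mul' := mk_mul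
  map_star' := mk_star

section Action

variable {G : Type*} [Group G]

/-- Invariance of an ideal under an action. -/
def IsInvariant (I : ClosedIdeal A) (α : G →* (A ≃⋆ₐ[ℂ] A)) : Prop :=
  ∀ g, ∀ a ∈ I, α g a ∈ I

/-- The restriction of an action to an invariant ideal. -/
def restrictAction (I : ClosedIdeal A) (α : G →* (A ≃⋆ₐ[ℂ] A)) (hI : I.IsInvariant α) :
    G →* (I.toStarSubalgebra ≃⋆ₐ[ℂ] I.toStarSubalgebra) where
  toFun g :=
    { toFun := fun x => ⟨α g x, hI g x x.2⟩
      invFun := fun x => ⟨α g⁻¹ x, hI g⁻¹ x x.2⟩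
      left_inv := fun x => Subtype.ext <| by
        change (α g⁻¹ * α g) (x : A) = x
        rw [← map_mul, inv_mul_cancel, map_one]; rfl
      right_inv := fun x => Subtype.ext <| by
        change (α g * α g⁻¹) (x : A) = x
        rw [← map_mul, mul_inv_cancel, map_one]; rfl
      map_mul' := fun x y => Subtype.ext (map_mul (α g) (x : A) y)
      map_add' := fun x y => Subtype.ext (map_add (α g) (x : A) y)
      map_star' := fun x => Subtype.ext (map_star (α g) (x : A))
      map_smul' := fun c x => Subtype.ext (map_smul (α g) c (x : A)) }
  map_one' := by
    ext x
    change α 1 (x : A) = x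
    rw [map_one]; rfl
  map_mul' g h := by
    ext x
    change α (g * h) (x : A) = α g (α h x)
    rw [map_mul]; rfl

/-- The induced map of `α g` on the quotient. -/
noncomputable def quotMap (I : ClosedIdeal A) (α : G →* (A ≃⋆ₐ[ℂ] A)) (hI : I.IsInvariant α) (g : G) :
    I.Quot → I.Quot :=
  Quotient.map (α g) fun a b h => by
    have h1 : a - b ∈ I := Submodule.quotientRel_def _ |>.1 h
    refine (Submodule.quotientRel_def _).2 ?_
    rw [← map_sub]
    exact hI g _ h1

theorem quotMap_mk {α : G →* (A ≃⋆ₐ[ℂ] A)} (hI : I.IsInvariant α) (g : G) (a : A) :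
    I.quotMap α hI g (I.qmk a) = I.qmk (α g a) := rfl

/-- The action induced on the quotient by an invariant ideal. -/
noncomputable def quotAction (I : ClosedIdeal A) (α : G →* (A ≃⋆ₐ[ℂ] A)) (hI : I.IsInvariant α) :
    G →* (I.Quot ≃⋆ₐ[ℂ] I.Quot) where
  toFun g :=
    { toFun := I.quotMap α hI g
      invFun := I.quotMap α hI g⁻¹
      left_inv := fun x => by
        obtain ⟨a, rfl⟩ := mk_surjective x
        change I.qmk ((α g⁻¹ * α g) a) = _
        rw [← map_mul, inv_mul_cancel, map_one]; rfl
      right_inv := fun x => by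
        obtain ⟨a, rfl⟩ := mk_surjective x
        change I.qmk ((α g * α g⁻¹) a) = _
        rw [← map_mul, mul_inv_cancel, map_one]; rfl
      map_mul' := fun x y => by
        obtain ⟨a, rfl⟩ := mk_surjective x
        obtain ⟨b, rfl⟩ := mk_surjective y
        simp only [← mk_mul, quotMap_mk, map_mul]
      map_add' := fun x y => by
        obtain ⟨a, rfl⟩ := mk_surjective x
        obtain ⟨b, rfl⟩ := mk_surjective y
        rw [← mk_add, quotMap_mk, quotMap_mk, quotMap_mk, map_add (α g), mk_add]
      map_star' := fun x => by
        obtain ⟨a, rfl⟩ := mk_surjective x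
        simp only [← mk_star, quotMap_mk, map_star]
      map_smul' := fun c x => by
        obtain ⟨a, rfl⟩ := mk_surjective x
        simp only [← map_smul, quotMap_mk] }
  map_one' := by
    ext x
    obtain ⟨a, rfl⟩ := mk_surjective x
    change I.qmk (α 1 a) = I.qmk a
    rw [map_one]; rfl
  map_mul' g h := by
    ext x
    obtain ⟨a, rfl⟩ := mk_surjective x
    change I.qmk (α (g * h) a) = I.qmk (α g (α h a))
    rw [map_mul]; rfl

end Action

end ClosedIdeal
/-! ### W-semigroups and their quotients -/

/-- A type with a distinguished relation `≺`. -/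
class HasPrec (S : Type*) where
  prec : S → S → Prop

infix:50 " ≺ " => HasPrec.prec

/-- W-semigroups: abelian monoids with an additive transitive relation `≺` satisfying the axioms
(W1), (W3), (W4) and `0 ≺ a`. -/
class IsWSemigroup (S : Type*) [AddCommMonoid S] [HasPrec S] : Prop where
  trans : ∀ a b c : S, a ≺ b → b ≺ c → a ≺ c
  zero_prec : ∀ a : S, 0 ≺ a
  w1 : ∀ a : S, ∃ s : ℕ → S, (∀ k, s k ≺ a) ∧ (∀ k, s k ≺ s (k + 1)) ∧ ∀ b, b ≺ a → ∃ k, b ≺ s k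
  w3 : ∀ a a' b b' : S, a' ≺ a → b' ≺ b → a' + b' ≺ a + b
  w4 : ∀ a b c : S, a ≺ b + c → ∃ b' c', a ≺ b' + c' ∧ b' ≺ b ∧ c' ≺ c

/-- W-morphisms: additive maps that preserve `≺` and are continuous. -/
structure IsWMorphism {S T : Type*} [AddCommMonoid S] [HasPrec S] [AddCommMonoid T] [HasPrec T]
    (f : S →+ T) : Prop where
  mono : ∀ a b, a ≺ b → f a ≺ f b
  cont : ∀ a b, b ≺ f a → ∃ a', a' ≺ a ∧ b ≺ f a'

/-- Closed ideals of a W-semigroup. -/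
structure IsClosedWIdeal {S : Type*} [AddCommMonoid S] [HasPrec S] (I : AddSubmonoid S) : Prop where
  mem_of_prec : ∀ a b, a ≺ b → b ∈ I → a ∈ I
  closed : ∀ a, (∀ b, b ≺ a → b ∈ I) → a ∈ I

/-- An additively closed preorder on an abelian monoid. -/
structure MonoidPreorder (S : Type*) [AddCommMonoid S] where
  rel : S → S → Prop
  refl : ∀ a, rel a a
  trans : ∀ a b c, rel a b → rel b c → rel a c
  add : ∀ a a' b b', rel a b → rel a' b' → rel (a + a') (b + b')

namespace MonoidPreorder

variable {S : Type*} [AddCommMonoid S] (P : MonoidPreorder S)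

/-- The antisymmetrization of the preorder, as a congruence. -/
def toAddCon : AddCon S where
  r a b := P.rel a b ∧ P.rel b a
  iseqv :=
    { refl := fun a => ⟨P.refl a, P.refl a⟩
      symm := fun h => ⟨h.2, h.1⟩
      trans := fun h k => ⟨P.trans _ _ _ h.1 k.1, P.trans _ _ _ k.2 h.2⟩ }
  add' := fun h k => ⟨P.add _ _ _ _ h.1 k.1, P.add _ _ _ _ h.2 k.2⟩

/-- The quotient monoid of `S` by the antisymmetrization of a preorder `≤`. -/
def Quot : Type _ := P.toAddCon.Quotient

instance : AddCommMonoid P.Quot := inferInstanceAs (AddCommMonoid P.toAddCon.Quotient)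

/-- The quotient map. -/
def proj : S →+ P.Quot := P.toAddCon.mk'

theorem proj_surjective : Function.Surjective P.proj := AddCon.mk'_surjective

theorem proj_eq_proj {a b : S} : P.proj a = P.proj b ↔ P.rel a b ∧ P.rel b a := P.toAddCon.eq

/-- The partial order induced on the quotient. -/
instance : PartialOrder P.Quot where
  le := Quotient.lift₂ P.rel fun _ _ _ _ h k => propext
    ⟨fun r => P.trans _ _ _ h.2 (P.trans _ _ _ r k.1),
      fun r => P.trans _ _ _ h.1 (P.trans _ _ _ r k.2)⟩
  le_refl x := by
    obtain ⟨a, rfl⟩ := P.proj_surjective x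
    exact P.refl a
  le_trans x y z h k := by
    obtain ⟨a, rfl⟩ := P.proj_surjective x
    obtain ⟨b, rfl⟩ := P.proj_surjective y
    obtain ⟨c, rfl⟩ := P.proj_surjective z
    exact P.trans a b c h k
  le_antisymm x y h k := by
    obtain ⟨a, rfl⟩ := P.proj_surjective x
    obtain ⟨b, rfl⟩ := P.proj_surjective y
    exact P.proj_eq_proj.2 ⟨h, k⟩

theorem proj_le_proj {a b : S} : P.proj a ≤ P.proj b ↔ P.rel a b := Iff.rfl

instance : IsOrderedAddMonoid P.Quot where
  add_le_add_left x y h z := by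
    obtain ⟨a, rfl⟩ := P.proj_surjective x
    obtain ⟨b, rfl⟩ := P.proj_surjective y
    obtain ⟨c, rfl⟩ := P.proj_surjective z
    exact P.add _ _ _ _ h (P.refl c)

/-- The relation on the quotient `S / (≺, ≤)`: `x ≺ [b]` holds if `x ≤ [a]` for some `a ≺ b`. -/
instance [HasPrec S] : HasPrec P.Quot where
  prec x y := ∃ a b : S, x ≤ P.proj a ∧ a ≺ b ∧ P.proj b = y

end MonoidPreorder

section Ideal

variable {S : Type*} [AddCommMonoid S] [HasPrec S] [IsWSemigroup S]

/-- The preorder `≤_J` of an ideal `J` of a W-semigroup: `a ≤_J b` if for every `x ≺ a` there is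
`y ∈ J` with `x ≺ b + y`. -/
def idealPreorder (J : AddSubmonoid S) : MonoidPreorder S where
  rel a b := ∀ x, x ≺ a → ∃ y ∈ J, x ≺ b + y
  refl a x hx := ⟨0, J.zero_mem, by rwa [add_zero]⟩
  trans a b c hab hbc x hx := by
    obtain ⟨y, hy, hxy⟩ := hab x hx
    obtain ⟨b', y', h1, h2, h3⟩ := IsWSemigroup.w4 _ _ _ hxy
    obtain ⟨z, hz, h4⟩ := hbc b' h2
    refine ⟨z + y, J.add_mem hz hy, ?_⟩
    rw [← add_assoc]
    exact IsWSemigroup.trans _ _ _ h1 (IsWSemigroup.w3 _ _ _ _ h4 h3)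
  add a a' b b' h h' x hx := by
    obtain ⟨c, c', h1, h2, h3⟩ := IsWSemigroup.w4 _ _ _ hx
    obtain ⟨y, hy, h4⟩ := h c h2
    obtain ⟨y', hy', h5⟩ := h' c' h3
    refine ⟨y + y', J.add_mem hy hy', ?_⟩
    rw [add_add_add_comm]
    exact IsWSemigroup.trans _ _ _ h1 (IsWSemigroup.w3 _ _ _ _ h4 h5)

/-- The quotient `S / J` of a W-semigroup by an ideal. -/
abbrev WIdealQuot (J : AddSubmonoid S) : Type _ := (idealPreorder J).Quot

end Ideal

section Dynamical

variable {S : Type*} [AddCommMonoid S] [HasPrec S] {G : Type*} [Group G]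

/-- The preorders on `S` that satisfy the four conditions defining the order of the dynamical
quotient. -/
structure IsDynamicalPreorder (η : G →* AddMonoid.End S) (r : S → S → Prop) : Prop where
  refl : ∀ a, r a a
  trans : ∀ a b c, r a b → r b c → r a c
  of_prec : ∀ a b, (∀ c, c ≺ a → c ≺ b) → r a b
  of_orbit : ∀ (g : G) (b : S), r (η g b) b
  of_closure : ∀ a b, (∀ c, c ≺ a → r c b) → r a b
  add : ∀ a₁ a₂ b₁ b₂, r a₁ b₁ → r a₂ b₂ → r (a₁ + a₂) (b₁ + b₂)

/-- The smallest dynamical preorder `≤_G`. -/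
def dynamicalPreorder (η : G →* AddMonoid.End S) : MonoidPreorder S where
  rel a b := ∀ r, IsDynamicalPreorder η r → r a b
  refl a _ hr := hr.refl a
  trans a b c h k r hr := hr.trans a b c (h r hr) (k r hr)
  add a a' b b' h k r hr := hr.add a a' b b' (h r hr) (k r hr)

/-- The dynamical W-semigroup `S / G`. -/
abbrev DynQuot (η : G →* AddMonoid.End S) : Type _ := (dynamicalPreorder η).Quot

end Dynamical

section Completion

/-- Sequences with `s n ≺ s (n + 1)` for all `n`. -/
def RapidSeq (S : Type*) [HasPrec S] : Type _ := {s : ℕ → S // ∀ n, s n ≺ s (n + 1)}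

variable {S : Type*} [AddCommMonoid S] [HasPrec S] [IsWSemigroup S]

instance : Zero (RapidSeq S) := ⟨⟨fun _ => 0, fun _ => IsWSemigroup.zero_prec _⟩⟩

instance : Add (RapidSeq S) :=
  ⟨fun s t => ⟨fun n => s.1 n + t.1 n, fun n => IsWSemigroup.w3 _ _ _ _ (s.2 n) (t.2 n)⟩⟩

instance : AddCommMonoid (RapidSeq S) where
  add_assoc s t u := Subtype.ext (funext fun n => add_assoc (s.1 n) (t.1 n) (u.1 n))
  zero_add s := Subtype.ext (funext fun n => zero_add (s.1 n))
  add_zero s := Subtype.ext (funext fun n => add_zero (s.1 n))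
  add_comm s t := Subtype.ext (funext fun n => add_comm (s.1 n) (t.1 n))
  nsmul := nsmulRec

theorem RapidSeq.prec_of_le (s : RapidSeq S) {a : S} {m : ℕ} (h : a ≺ s.1 m) {n : ℕ} (hmn : m ≤ n) :
    a ≺ s.1 n := by
  induction n, hmn using Nat.le_induction with
  | base => exact h
  | succ k _ ih => exact IsWSemigroup.trans _ _ _ ih (s.2 k)

variable (S) in
/-- The preorder on rapidly increasing sequences: `s ≤ t` if every `s n` satisfies `s n ≺ t m` for
some `m`. -/
def rapidPreorder : MonoidPreorder (RapidSeq S) where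
  rel s t := ∀ n, ∃ m, s.1 n ≺ t.1 m
  refl s n := ⟨n + 1, s.2 n⟩
  trans s t u h k n := by
    obtain ⟨m, hm⟩ := h n
    obtain ⟨l, hl⟩ := k m
    exact ⟨l, IsWSemigroup.trans _ _ _ hm hl⟩
  add s s' t t' h k n := by
    obtain ⟨m, hm⟩ := h n
    obtain ⟨l, hl⟩ := k n
    exact ⟨max m l, IsWSemigroup.w3 _ _ _ _ (t.prec_of_le hm (le_max_left _ _))
      (t'.prec_of_le hl (le_max_right _ _))⟩

variable (S) in
/-- The Cu-completion `γ(S)` of a W-semigroup. -/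
abbrev CuCompletion : Type _ := (rapidPreorder S).Quot

end Completion

section Cu

variable {S : Type*} [AddCommMonoid S] [PartialOrder S]

/-- Compact containment (the sequential way-below relation). -/
def WayBelow (a b : S) : Prop :=
  ∀ (s : ℕ → S) (c : S), Monotone s → IsLUB (Set.range s) c → b ≤ c → ∃ n, a ≤ s n

variable (S) in
/-- Abstract Cuntz semigroups: positively ordered monoids satisfying (O1)-(O4). -/
class IsCuSemigroup : Prop where
  zero_le : ∀ a : S, 0 ≤ a
  add_le_add : ∀ a b c d : S, a ≤ b → c ≤ d → a + c ≤ b + d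
  o1 : ∀ s : ℕ → S, Monotone s → ∃ a, IsLUB (Set.range s) a
  o2 : ∀ a : S, ∃ s : ℕ → S, (∀ n, WayBelow (s n) (s (n + 1))) ∧ IsLUB (Set.range s) a
  o3 : ∀ a' a b' b : S, WayBelow a' a → WayBelow b' b → WayBelow (a' + b') (a + b)
  o4 : ∀ (s t : ℕ → S) (a b : S), Monotone s → Monotone t → IsLUB (Set.range s) a →
    IsLUB (Set.range t) b → IsLUB (Set.range fun n => s n + t n) (a + b)

/-- Ideals of a Cu-semigroup: submonoids that are hereditary and closed under suprema of increasing
sequences. -/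
structure IsCuIdeal (K : AddSubmonoid S) : Prop where
  mem_of_le : ∀ a b, a ≤ b → b ∈ K → a ∈ K
  sup_mem : ∀ (s : ℕ → S) (a : S), Monotone s → (∀ n, s n ∈ K) → IsLUB (Set.range s) a → a ∈ K

variable [IsOrderedAddMonoid S]

/-- The preorder `≤_K` of an ideal `K` of a Cu-semigroup: `a ≤_K b` if `a ≤ b + z` for some
`z ∈ K`. -/
def cuIdealPreorder (K : AddSubmonoid S) : MonoidPreorder S where
  rel a b := ∃ z ∈ K, a ≤ b + z
  refl a := ⟨0, K.zero_mem, (add_zero a).ge⟩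
  trans a b c := by
    rintro ⟨z, hz, h⟩ ⟨w, hw, k⟩
    refine ⟨w + z, K.add_mem hw hz, h.trans ?_⟩
    rw [← add_assoc]
    exact add_le_add k le_rfl
  add a a' b b' := by
    rintro ⟨z, hz, h⟩ ⟨w, hw, k⟩
    refine ⟨z + w, K.add_mem hz hw, ?_⟩
    rw [add_add_add_comm]
    exact add_le_add h k

/-- The quotient of a Cu-semigroup by an ideal. -/
abbrev CuIdealQuot (K : AddSubmonoid S) : Type _ := (cuIdealPreorder K).Quot

end Cu

/-! ### The Cuntz semigroup `W(A)` -/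

section Generic

variable {B : Type*} [NonUnitalCStarAlgebra B]

/-- The element `(b - δ)₊`. -/
noncomputable def cutdown (δ : ℝ) (b : B) : B := cfcₙ (fun t : ℝ => max (t - δ) 0) b

theorem nonneg_iff {b : B} : 0 ≤ b ↔ ∃ c, b = star c * c :=
  CStarAlgebra.nonneg_iff_eq_star_mul_self

/-- The algebra as an ideal of itself. -/
def ClosedIdeal.whole (B : Type*) [NonUnitalCStarAlgebra B] : ClosedIdeal B where
  __ := (⊤ : Submodule ℂ B)
  mul_mem_left' := fun _ _ _ => trivial
  mul_mem_right' := fun _ _ _ => trivial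
  isClosed' := isClosed_univ

theorem exists_approx {b : B} (hb : 0 ≤ b) {ε : ℝ} (hε : 0 < ε) :
    ∃ x : B, ‖b - x * b * star x‖ < ε := by
  obtain ⟨u, -, h1, h2⟩ := (ClosedIdeal.whole B).exists_unit b trivial (ε / 3) (by positivity)
  have hs : star b = b := (IsSelfAdjoint.of_nonneg hb).star_eq
  refine ⟨star u, ?_⟩
  set d := b - b * u with hd
  have hd' : star d = b - star u * b := by rw [hd, star_sub, star_mul, hs]
  have e : b - star u * b * star (star u) = d + (star d - (star d - star d * u)) := by
    rw [hd', hd, star_star]; noncomm_ring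
  rw [e]
  have k1 := norm_add_le d (star d - (star d - star d * u))
  have k2 := norm_sub_le (star d) (star d - star d * u)
  have k3 := h2 (star d)
  have k4 : ‖star d‖ = ‖d‖ := norm_star d
  linarith

end Generic

section Cuntz

variable {A : Type*} [NonUnitalCStarAlgebra A]
variable {k l m n k' l' : Type*} [Fintype k] [Fintype l] [Fintype m] [Fintype n] [Fintype k']
  [Fintype l']

theorem matrix_conj_conj (x : Matrix k l A) (y : Matrix l m A) (c : Matrix m m A) :
    x * (y * c * y.conjTranspose) * x.conjTranspose = x * y * c * (x * y).conjTranspose := by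
  rw [Matrix.conjTranspose_mul]
  simp only [Matrix.mul_assoc]

theorem matrix_conj_sub (x : Matrix k l A) (b c : Matrix l l A) :
    x * (b - c) * x.conjTranspose = x * b * x.conjTranspose - x * c * x.conjTranspose := by
  rw [Matrix.mul_sub, Matrix.sub_mul]

/-- Cuntz subequivalence `a ≾ b` of square matrices over `A`, possibly of different sizes: for
every `ε > 0` there is a rectangular matrix `x` over `A` with `‖a - x b x*‖ < ε`. -/
def CuntzLE (a : CStarMatrix m m A) (b : CStarMatrix n n A) : Prop :=
  ∀ ε : ℝ, 0 < ε → ∃ x : CStarMatrix m n A, ‖a - x * b * x.conjTranspose‖ < ε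

theorem CuntzLE.trans {a : CStarMatrix l l A} {b : CStarMatrix m m A} {c : CStarMatrix n n A}
    (h : CuntzLE a b) (h' : CuntzLE b c) : CuntzLE a c := by
  intro ε hε
  obtain ⟨x, hx⟩ := h (ε / 2) (half_pos hε)
  have hcont : Continuous fun d : CStarMatrix m m A => x * d * x.conjTranspose := by
    refine continuous_pi fun i => continuous_pi fun j => ?_
    simp only [CStarMatrix.mul_apply]
    refine continuous_finsetSum _ fun s _ => (continuous_finsetSum _ fun s' _ => ?_).mul
      continuous_const
    exact continuous_const.mul ((continuous_apply s).comp (continuous_apply s'))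
  have h0 : x * (0 : CStarMatrix m m A) * x.conjTranspose = 0 := by
    rw [CStarMatrix.mul_zero, CStarMatrix.zero_mul]
  obtain ⟨δ, hδ, hd⟩ := Metric.continuous_iff.1 hcont 0 (ε / 2) (half_pos hε)
  obtain ⟨y, hy⟩ := h' δ hδ
  have hd' := hd (b - y * c * y.conjTranspose) (by rwa [dist_zero_right])
  simp only [h0] at hd'
  rw [dist_zero_right] at hd'
  refine ⟨x * y, ?_⟩
  have e : a - x * y * c * (x * y).conjTranspose =
      (a - x * b * x.conjTranspose) + x * (b - y * c * y.conjTranspose) * x.conjTranspose := by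
    have e1 : x * (b - y * c * y.conjTranspose) * x.conjTranspose =
        x * b * x.conjTranspose - x * (y * c * y.conjTranspose) * x.conjTranspose :=
      matrix_conj_sub (A := A) x b _
    have e2 : x * (y * c * y.conjTranspose) * x.conjTranspose =
        x * y * c * (x * y).conjTranspose := matrix_conj_conj (A := A) x y c
    rw [e1, e2, sub_add_sub_cancel]
  rw [e]
  exact (norm_add_le _ _).trans_lt (by linarith)

theorem CuntzLE.refl {a : CStarMatrix n n A} (ha : 0 ≤ a) : CuntzLE a a :=
  fun _ hε => exists_approx ha hε

/-- Simultaneous permutation of rows and columns. -/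
def permute (e : n ≃ m) (a : CStarMatrix m m A) : CStarMatrix n n A :=
  CStarMatrix.ofMatrix (Matrix.submatrix a e e)

theorem CuntzLE.permute_right (e : n ≃ m) {a : CStarMatrix m m A} (ha : 0 ≤ a) :
    CuntzLE a (permute e a) := by
  intro ε hε
  obtain ⟨y, hy⟩ := CuntzLE.refl ha ε hε
  refine ⟨CStarMatrix.ofMatrix (Matrix.submatrix y id e), ?_⟩
  convert hy using 3
  have h1 := Matrix.submatrix_mul_equiv (α := A) y a id e e
  have h2 := Matrix.submatrix_mul_equiv (α := A) (y * a : CStarMatrix m m A)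
    (Matrix.conjTranspose (α := A) y) id e id
  refine Eq.trans ?_ h2
  exact congrArg (fun z : Matrix m n A => z * (Matrix.submatrix
    (Matrix.conjTranspose (α := A) y) e id)) h1

theorem permute_nonneg (e : n ≃ m) {a : CStarMatrix m m A} (ha : 0 ≤ a) : 0 ≤ permute e a := by
  obtain ⟨c, rfl⟩ := nonneg_iff.1 ha
  refine nonneg_iff.2 ⟨permute e c, ?_⟩
  exact (Matrix.submatrix_mul_equiv (α := A) (Matrix.conjTranspose (α := A) c) c e e e).symm

theorem CuntzLE.permute_left (e : n ≃ m) {a : CStarMatrix m m A} (ha : 0 ≤ a) :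
    CuntzLE (permute e a) a := by
  have := CuntzLE.permute_right e.symm (permute_nonneg e ha)
  have e1 : permute e.symm (permute e a) = a := by
    ext i j
    change a (e (e.symm i)) (e (e.symm j)) = _
    simp
  rwa [e1] at this

/-- The block diagonal matrix `a ⊕ b`. -/
def dsum (a : CStarMatrix m m A) (b : CStarMatrix n n A) : CStarMatrix (m ⊕ n) (m ⊕ n) A :=
  CStarMatrix.ofMatrix (Matrix.fromBlocks a 0 0 b)

theorem blocks_conj (x : Matrix k m A) (y : Matrix l n A) (a : Matrix m m A) (b : Matrix n n A) :
    Matrix.fromBlocks x 0 0 y * Matrix.fromBlocks a 0 0 b *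
      (Matrix.fromBlocks x 0 0 y : Matrix (k ⊕ l) (m ⊕ n) A).conjTranspose =
      Matrix.fromBlocks (x * a * x.conjTranspose) 0 0 (y * b * y.conjTranspose) := by
  rw [Matrix.fromBlocks_multiply, Matrix.fromBlocks_conjTranspose, Matrix.fromBlocks_multiply]
  simp only [Matrix.mul_zero, Matrix.zero_mul, add_zero, zero_add, Matrix.conjTranspose_zero]

theorem blocks_star_mul_self (c : Matrix m m A) (d : Matrix n n A) :
    Matrix.fromBlocks (c.conjTranspose * c) 0 0 (d.conjTranspose * d) =
      (Matrix.fromBlocks c 0 0 d : Matrix (m ⊕ n) (m ⊕ n) A).conjTranspose *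
        Matrix.fromBlocks c 0 0 d := by
  rw [Matrix.fromBlocks_conjTranspose, Matrix.fromBlocks_multiply]
  simp only [Matrix.mul_zero, Matrix.zero_mul, add_zero, zero_add, Matrix.conjTranspose_zero]

theorem dsum_nonneg {a : CStarMatrix m m A} {b : CStarMatrix n n A} (ha : 0 ≤ a) (hb : 0 ≤ b) :
    0 ≤ dsum a b := by
  obtain ⟨c, rfl⟩ := nonneg_iff.1 ha
  obtain ⟨d, rfl⟩ := nonneg_iff.1 hb
  exact nonneg_iff.2 ⟨dsum c d, blocks_star_mul_self (A := A) c d⟩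

theorem dsum_sub (a c : CStarMatrix m m A) (b d : CStarMatrix n n A) :
    dsum (a - c) (b - d) = dsum a b - dsum c d := by
  ext i j
  rcases i with i | i <;> rcases j with j | j
  · rfl
  · exact (sub_zero (0 : A)).symm
  · exact (sub_zero (0 : A)).symm
  · rfl

theorem CuntzLE.dsum {a : CStarMatrix k k A} {b : CStarMatrix m m A} {a' : CStarMatrix l l A}
    {b' : CStarMatrix n n A} (h : CuntzLE a a') (h' : CuntzLE b b') :
    CuntzLE (dsum a b) (dsum a' b') := by
  intro ε hε
  have hcont : Continuous fun d : CStarMatrix k k A × CStarMatrix m m A => DynCuntz.dsum d.1 d.2 := by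
    refine continuous_pi fun i => continuous_pi fun j => ?_
    rcases i with i | i <;> rcases j with j | j <;> simp only [DynCuntz.dsum]
    · exact (continuous_apply j).comp ((continuous_apply i).comp continuous_fst)
    · exact continuous_const
    · exact continuous_const
    · exact (continuous_apply j).comp ((continuous_apply i).comp continuous_snd)
  have h00 : DynCuntz.dsum (0 : CStarMatrix k k A) (0 : CStarMatrix m m A) = 0 :=
    Matrix.fromBlocks_zero
  obtain ⟨δ, hδ, hd⟩ := Metric.continuous_iff.1 hcont (0, 0) ε hε
  obtain ⟨x, hx⟩ := h δ hδ
  obtain ⟨y, hy⟩ := h' δ hδ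
  have hd' := hd (a - x * a' * x.conjTranspose, b - y * b' * y.conjTranspose)
    (by rw [Prod.dist_eq, dist_zero_right, dist_zero_right]; exact max_lt hx hy)
  simp only [h00] at hd'
  rw [dist_zero_right] at hd'
  refine ⟨CStarMatrix.ofMatrix (Matrix.fromBlocks x 0 0 y), ?_⟩
  have e : (CStarMatrix.ofMatrix (Matrix.fromBlocks x 0 0 y) : CStarMatrix (k ⊕ m) (l ⊕ n) A) *
      DynCuntz.dsum a' b' * (CStarMatrix.ofMatrix (Matrix.fromBlocks x 0 0 y) :
        CStarMatrix (k ⊕ m) (l ⊕ n) A).conjTranspose =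
      DynCuntz.dsum (x * a' * x.conjTranspose) (y * b' * y.conjTranspose) :=
    blocks_conj (A := A) x y a' b'
  rw [e, ← dsum_sub]
  exact hd'

end Cuntz

/-- Positive elements of `M_∞(A)`: square matrices over `A` that are positive. -/
structure PosMat (A : Type*) [NonUnitalCStarAlgebra A] where
  size : ℕ
  mat : CStarMatrix (Fin size) (Fin size) A
  nonneg : 0 ≤ mat

section W

variable {A : Type*} [NonUnitalCStarAlgebra A]

namespace PosMat

instance : Zero (PosMat A) := ⟨⟨0, 0, le_rfl⟩⟩

/-- The block sum `a ⊕ b` as a matrix indexed by `Fin (m + n)`. -/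
instance : Add (PosMat A) :=
  ⟨fun a b => ⟨a.size + b.size, permute finSumFinEquiv.symm (dsum a.mat b.mat),
    permute_nonneg _ (dsum_nonneg a.nonneg b.nonneg)⟩⟩

/-- Cuntz subequivalence. -/
def Sub (a b : PosMat A) : Prop := CuntzLE a.mat b.mat

/-- Cuntz equivalence. -/
instance setoid (A : Type*) [NonUnitalCStarAlgebra A] : Setoid (PosMat A) where
  r a b := a.Sub b ∧ b.Sub a
  iseqv :=
    { refl := fun a => ⟨.refl a.nonneg, .refl a.nonneg⟩
      symm := fun h => ⟨h.2, h.1⟩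
      trans := fun h h' => ⟨h.1.trans h'.1, h'.2.trans h.2⟩ }

theorem Sub.add {a a' b b' : PosMat A} (h : a.Sub a') (h' : b.Sub b') : (a + b).Sub (a' + b') :=
  (CuntzLE.permute_left _ (dsum_nonneg a.nonneg b.nonneg)).trans
    ((CuntzLE.dsum h h').trans (CuntzLE.permute_right _ (dsum_nonneg a'.nonneg b'.nonneg)))

theorem equiv_of_permute {a b : PosMat A} (e : Fin a.size ≃ Fin b.size)
    (h : a.mat = permute e b.mat) : a ≈ b := by
  refine ⟨?_, ?_⟩
  · change CuntzLE a.mat b.mat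
    rw [h]
    exact CuntzLE.permute_left e b.nonneg
  · change CuntzLE b.mat a.mat
    rw [h]
    exact CuntzLE.permute_right e b.nonneg

theorem add_comm_equiv (a b : PosMat A) : a + b ≈ b + a := by
  refine equiv_of_permute (finSumFinEquiv.symm.trans
    ((Equiv.sumComm (Fin a.size) (Fin b.size)).trans finSumFinEquiv)) ?_
  ext i j
  obtain ⟨i, rfl⟩ := finSumFinEquiv.surjective i
  obtain ⟨j, rfl⟩ := finSumFinEquiv.surjective j
  change dsum a.mat b.mat _ _ = dsum b.mat a.mat _ _
  simp only [Equiv.trans_apply, Equiv.symm_apply_apply]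
  rcases i with i | i <;> rcases j with j | j <;> rfl

theorem add_assoc_equiv (a b c : PosMat A) : a + b + c ≈ a + (b + c) := by
  refine equiv_of_permute (finSumFinEquiv.symm.trans
    ((Equiv.sumCongr finSumFinEquiv.symm (Equiv.refl _)).trans
      ((Equiv.sumAssoc (Fin a.size) (Fin b.size) (Fin c.size)).trans
        ((Equiv.sumCongr (Equiv.refl _) finSumFinEquiv).trans finSumFinEquiv)))) ?_
  ext i j
  obtain ⟨i, rfl⟩ := finSumFinEquiv.surjective i
  obtain ⟨j, rfl⟩ := finSumFinEquiv.surjective j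
  change dsum (permute finSumFinEquiv.symm (dsum a.mat b.mat)) c.mat _ _ =
    dsum a.mat (permute finSumFinEquiv.symm (dsum b.mat c.mat)) _ _
  simp only [Equiv.trans_apply, Equiv.symm_apply_apply]
  rcases i with i | i <;> rcases j with j | j
  · obtain ⟨i, rfl⟩ := finSumFinEquiv.surjective i
    obtain ⟨j, rfl⟩ := finSumFinEquiv.surjective j
    change dsum a.mat b.mat _ _ = _
    simp only [Equiv.sumCongr_apply, Sum.map_inl, Equiv.symm_apply_apply]
    rcases i with i | i <;> rcases j with j | j <;> try rfl
    change _ = dsum b.mat c.mat (finSumFinEquiv.symm (finSumFinEquiv (Sum.inl i)))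
      (finSumFinEquiv.symm (finSumFinEquiv (Sum.inl j)))
    simp only [Equiv.symm_apply_apply]
    rfl
  · obtain ⟨i, rfl⟩ := finSumFinEquiv.surjective i
    simp only [Equiv.sumCongr_apply, Sum.map_inl, Equiv.symm_apply_apply]
    rcases i with i | i
    · rfl
    change _ = dsum b.mat c.mat (finSumFinEquiv.symm (finSumFinEquiv (Sum.inl i)))
      (finSumFinEquiv.symm (finSumFinEquiv (Sum.inr j)))
    simp only [Equiv.symm_apply_apply]
    rfl
  · obtain ⟨j, rfl⟩ := finSumFinEquiv.surjective j
    simp only [Equiv.sumCongr_apply, Sum.map_inl, Equiv.symm_apply_apply]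
    rcases j with j | j
    · rfl
    change _ = dsum b.mat c.mat (finSumFinEquiv.symm (finSumFinEquiv (Sum.inr i)))
      (finSumFinEquiv.symm (finSumFinEquiv (Sum.inl j)))
    simp only [Equiv.symm_apply_apply]
    rfl
  · change _ = dsum b.mat c.mat (finSumFinEquiv.symm (finSumFinEquiv (Sum.inr i)))
      (finSumFinEquiv.symm (finSumFinEquiv (Sum.inr j)))
    simp only [Equiv.symm_apply_apply]
    rfl

theorem add_zero_equiv (a : PosMat A) : a + 0 ≈ a := by
  refine equiv_of_permute (finSumFinEquiv.symm.trans (Equiv.sumEmpty (Fin a.size) (Fin 0))) ?_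
  ext i j
  obtain ⟨i, rfl⟩ := finSumFinEquiv.surjective i
  obtain ⟨j, rfl⟩ := finSumFinEquiv.surjective j
  change dsum a.mat _ _ _ = a.mat _ _
  simp only [Equiv.trans_apply, Equiv.symm_apply_apply]
  rcases i with i | i
  · rcases j with j | j
    · rfl
    · exact j.elim0
  · exact i.elim0

end PosMat

/-- The Cuntz semigroup `W(A) = M_∞(A)₊ / ∼`. -/
def W (A : Type*) [NonUnitalCStarAlgebra A] : Type _ := Quotient (PosMat.setoid A)

namespace W

/-- The class of a positive matrix. -/
def mk (a : PosMat A) : W A := Quotient.mk _ a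

theorem mk_surjective : Function.Surjective (mk (A := A)) := Quotient.mk_surjective

theorem mk_eq_mk {a b : PosMat A} : mk a = mk b ↔ a.Sub b ∧ b.Sub a := Quotient.eq

/-- Addition `[a] + [b] = [a ⊕ b]`. -/
instance : Add (W A) :=
  ⟨Quotient.map₂ (· + ·) fun _ _ h _ _ h' => ⟨h.1.add h'.1, h.2.add h'.2⟩⟩

theorem mk_add (a b : PosMat A) : mk (a + b) = mk a + mk b := rfl

instance : Zero (W A) := ⟨mk 0⟩

instance : AddCommMonoid (W A) where
  add_assoc x y z := by
    obtain ⟨a, rfl⟩ := mk_surjective x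
    obtain ⟨b, rfl⟩ := mk_surjective y
    obtain ⟨c, rfl⟩ := mk_surjective z
    exact Quotient.sound (PosMat.add_assoc_equiv a b c)
  add_comm x y := by
    obtain ⟨a, rfl⟩ := mk_surjective x
    obtain ⟨b, rfl⟩ := mk_surjective y
    exact Quotient.sound (PosMat.add_comm_equiv a b)
  add_zero x := by
    obtain ⟨a, rfl⟩ := mk_surjective x
    exact Quotient.sound (PosMat.add_zero_equiv a)
  zero_add x := by
    obtain ⟨a, rfl⟩ := mk_surjective x
    exact Quotient.sound (Setoid.trans (PosMat.add_comm_equiv 0 a) (PosMat.add_zero_equiv a))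
  nsmul := nsmulRec

/-- The relation `[a] ≺ [b]`: `a ≾ (b - δ)₊` for some `δ > 0`. -/
instance : HasPrec (W A) where
  prec x y := ∃ a b : PosMat A, mk a = x ∧ mk b = y ∧ ∃ δ : ℝ, 0 < δ ∧
    CuntzLE a.mat (cutdown δ b.mat)

end W

section Map

variable {B : Type*} [NonUnitalCStarAlgebra B]

/-- Entrywise application of a `*`-homomorphism to a positive matrix. -/
def PosMat.map (φ : A →⋆ₙₐ[ℂ] B) (a : PosMat A) : PosMat B where
  size := a.size
  mat := CStarMatrix.mapₙₐ φ a.mat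
  nonneg := by
    obtain ⟨c, hc⟩ := nonneg_iff.1 a.nonneg
    exact nonneg_iff.2 ⟨CStarMatrix.mapₙₐ φ c, by rw [hc, map_mul, map_star]⟩

theorem norm_map_le {n : Type*} [Fintype n] (φ : A →⋆ₙₐ[ℂ] B) (a : CStarMatrix n n A) :
    ‖CStarMatrix.mapₙₐ (n := n) φ a‖ ≤ ‖a‖ :=
  NonUnitalStarAlgHom.norm_apply_le (CStarMatrix.mapₙₐ (n := n) φ) a

theorem matrix_map_conj {m n : Type*} [Fintype n] (φ : A →⋆ₙₐ[ℂ] B) (x : Matrix m n A)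
    (b : Matrix n n A) (i j : m) :
    φ ((x * b * x.conjTranspose) i j) = (x.map φ * b.map φ * (x.map φ).conjTranspose) i j := by
  simp only [Matrix.mul_apply, map_sum, map_mul, Matrix.map_apply, Matrix.conjTranspose_apply,
    map_star]

theorem PosMat.Sub.map (φ : A →⋆ₙₐ[ℂ] B) {a b : PosMat A} (h : a.Sub b) :
    (a.map φ).Sub (b.map φ) := by
  intro ε hε
  obtain ⟨x, hx⟩ := h ε hε
  refine ⟨x.map φ, ?_⟩
  refine lt_of_le_of_lt (le_of_eq ?_) ((norm_map_le φ _).trans_lt hx)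
  congr 1
  rw [map_sub]
  congr 1
  ext i j
  exact (matrix_map_conj φ x b.mat i j).symm

theorem dsum_map {m n : Type*} [Fintype m] [Fintype n] (φ : A →⋆ₙₐ[ℂ] B) (a : CStarMatrix m m A)
    (b : CStarMatrix n n A) :
    CStarMatrix.mapₙₐ φ (dsum a b) = dsum (CStarMatrix.mapₙₐ φ a) (CStarMatrix.mapₙₐ φ b) := by
  ext i j
  rcases i with i | i <;> rcases j with j | j
  · rfl
  · exact map_zero φ
  · exact map_zero φ
  · rfl

/-- The map `W(φ)` induced by a `*`-homomorphism. -/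
def W.map (φ : A →⋆ₙₐ[ℂ] B) : W A →+ W B where
  toFun := Quotient.map (PosMat.map φ) fun _ _ h => ⟨h.1.map φ, h.2.map φ⟩
  map_zero' := Quotient.sound <| PosMat.equiv_of_permute (Equiv.refl _) <| by
    ext i
    exact i.elim0
  map_add' x y := by
    obtain ⟨a, rfl⟩ := W.mk_surjective x
    obtain ⟨b, rfl⟩ := W.mk_surjective y
    exact Quotient.sound (PosMat.equiv_of_permute (Equiv.refl _)
      (congrArg (permute finSumFinEquiv.symm) (dsum_map φ a.mat b.mat)))

theorem W.map_mk (φ : A →⋆ₙₐ[ℂ] B) (a : PosMat A) : W.map φ (W.mk a) = W.mk (a.map φ) := rfl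

end Map

section Action

variable {G : Type*} [Group G]

/-- The action on `W(A)` induced by an action on `A`: `g [a] = [g a]`. -/
def W.act (α : G →* (A ≃⋆ₐ[ℂ] A)) : G →* AddMonoid.End (W A) where
  toFun g := W.map ((α g : A ≃⋆ₐ[ℂ] A) : A →⋆ₙₐ[ℂ] A)
  map_one' := by
    rw [map_one]
    ext x
    obtain ⟨a, rfl⟩ := W.mk_surjective x
    rfl
  map_mul' g h := by
    rw [map_mul]
    ext x
    obtain ⟨a, rfl⟩ := W.mk_surjective x
    rfl

/-- The dynamical Cuntz semigroup `W_G(A) = W(A) / G`. -/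
abbrev WG (α : G →* (A ≃⋆ₐ[ℂ] A)) : Type _ := DynQuot (W.act α)

/-- The complete dynamical Cuntz semigroup `Cu_G(A) = γ(W_G(A))`. -/
abbrev CuG (α : G →* (A ≃⋆ₐ[ℂ] A)) [IsWSemigroup (WG α)] : Type _ := CuCompletion (WG α)

end Action

end W

end DynCuntz

open DynCuntz

/-! Everything rests on three facts about `W`. The map induced by the inclusion of `I` reflects `≺`
(`W.map_incl_prec_iff`), its image is a closed ideal (`W.range_incl_isClosedWIdeal`), and Cuntz
comparison modulo `I` is comparison up to adding an element of that ideal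
(`W.idealPreorder_of_map_proj`). For the third, lift a comparison of `a` with `b` modulo `I` to a
matrix `x` for which `z = a - x b x*` has norm less than `ε` modulo `I`. Then `(z - ε)₊` has entries
in `I`, and `(a - ε)₊ ≾ x b x* + (z - ε)₊ ≾ b ⊕ (z - ε)₊` (`PosMat.exists_cutdown_sub_add`).

Since `≤_G` is the smallest preorder with four closure properties, each statement about it is proved
by exhibiting a relation with these properties. `dynamicalPreorder_isContinuous` makes the quotients
W-semigroups. The embedding survives because a chain of comparisons that ends in the closed ideal
never leaves it (`dynamicalPreorder_reflect`). The quotient survives because "all lifts are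
comparable modulo `K`" is again such a relation (`dynamicalPreorder_quotient`).

An element of the completion amounts to the countably generated round lower set of the elements of
`S` below it; order is inclusion and suprema are unions. The embedding then passes to completions at
once. For the quotient, each comparison of terms costs an element of the ideal. In lifting a
sequence the cost is absorbed by the next term (`CuCompletion.map_surjective_of_quotient`); in
comparing two sequences the countably many costs are summed into a single element of the ideal
(`CuCompletion.cuIdealPreorder_rel_iff`). -/

namespace DynCuntz

set_option linter.unusedSectionVars false

/-! ### Interpolation in W-semigroups -/

section WSemigroup

variable {S : Type*} [AddCommMonoid S] [HasPrec S] [IsWSemigroup S]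

/-- Every element is the limit of a rapidly increasing sequence below it. -/
theorem exists_rapidSeq (a : S) :
    ∃ s : RapidSeq S, (∀ k, s.1 k ≺ a) ∧ ∀ b, b ≺ a → ∃ k, b ≺ s.1 k := by
  obtain ⟨s, h1, h2, h3⟩ := IsWSemigroup.w1 a
  exact ⟨⟨s, h2⟩, h1, h3⟩

theorem exists_prec_prec {a b c : S} (ha : a ≺ c) (hb : b ≺ c) : ∃ d, d ≺ c ∧ a ≺ d ∧ b ≺ d := by
  obtain ⟨s, h1, h2⟩ := exists_rapidSeq c
  obtain ⟨k, hk⟩ := h2 a ha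
  obtain ⟨l, hl⟩ := h2 b hb
  exact ⟨s.1 (max k l), h1 _, s.prec_of_le hk (le_max_left _ _), s.prec_of_le hl (le_max_right _ _)⟩

theorem exists_prec_between {a b : S} (h : a ≺ b) : ∃ c, c ≺ b ∧ a ≺ c := by
  obtain ⟨c, h1, h2, -⟩ := exists_prec_prec h h
  exact ⟨c, h1, h2⟩

theorem prec_add_right_of_prec {a b : S} (h : a ≺ b) (c : S) : a ≺ b + c := by
  simpa using IsWSemigroup.w3 _ _ _ _ h (IsWSemigroup.zero_prec c)

/-- Heredity is assumed only for `≺`, and `a` need not be `≺ a + b`. But everything `≺ a` is `≺ a +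
b`, and closedness then recovers `a`. -/
theorem IsClosedWIdeal.left_mem {J : AddSubmonoid S} (hJ : IsClosedWIdeal J) {a b : S}
    (h : a + b ∈ J) : a ∈ J :=
  hJ.closed a fun _ hc => hJ.mem_of_prec _ _ (prec_add_right_of_prec hc b) h

theorem IsClosedWIdeal.right_mem {J : AddSubmonoid S} (hJ : IsClosedWIdeal J) {a b : S}
    (h : a + b ∈ J) : b ∈ J :=
  hJ.left_mem (add_comm a b ▸ h)

end WSemigroup

/-! ### Continuous preorders and their quotients -/

namespace MonoidPreorder

variable {S : Type*} [AddCommMonoid S] [HasPrec S]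

/-- A preorder on a W-semigroup whose quotient map is going to be a W-morphism. -/
structure IsContinuous (P : MonoidPreorder S) : Prop where
  of_prec : ∀ a b, a ≺ b → P.rel a b
  cont : ∀ a b c, a ≺ b → P.rel b c → ∃ d, d ≺ c ∧ P.rel a d

namespace IsContinuous

variable {P : MonoidPreorder S} (hP : P.IsContinuous)
include hP

/-- In the definition of `≺` on the quotient the upper representative may vary; continuity moves the
comparison to any prescribed representative. -/
theorem prec_proj_iff {x : P.Quot} {b : S} : x ≺ P.proj b ↔ ∃ a, a ≺ b ∧ x ≤ P.proj a := by
  constructor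
  · rintro ⟨a, b', hx, hab, hb⟩
    obtain ⟨d, hd, had⟩ := hP.cont _ _ _ hab (P.proj_eq_proj.1 hb).1
    exact ⟨d, hd, hx.trans had⟩
  · rintro ⟨a, hab, hx⟩
    exact ⟨a, b, hx, hab, rfl⟩

theorem proj_prec_proj {a b : S} (h : a ≺ b) : P.proj a ≺ P.proj b := ⟨a, b, le_rfl, h, rfl⟩

theorem le_of_prec {x y : P.Quot} (h : x ≺ y) : x ≤ y := by
  obtain ⟨a, b, hx, hab, rfl⟩ := h
  exact hx.trans (hP.of_prec _ _ hab)

theorem prec_of_le_of_prec {x y z : P.Quot} (h : x ≤ y) (h' : y ≺ z) : x ≺ z := by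
  obtain ⟨a, b, hx, hab, rfl⟩ := h'
  exact ⟨a, b, h.trans hx, hab, rfl⟩

theorem prec_of_prec_of_le {x y z : P.Quot} (h : x ≺ y) (h' : y ≤ z) : x ≺ z := by
  obtain ⟨a, b, hx, hab, rfl⟩ := h
  obtain ⟨c, rfl⟩ := P.proj_surjective z
  obtain ⟨d, hd, had⟩ := hP.cont _ _ _ hab h'
  exact ⟨d, c, hx.trans had, hd, rfl⟩

theorem isWSemigroup [IsWSemigroup S] : IsWSemigroup P.Quot where
  trans x y z h h' := hP.prec_of_le_of_prec (hP.le_of_prec h) h'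
  zero_prec x := by
    obtain ⟨a, rfl⟩ := P.proj_surjective x
    exact hP.proj_prec_proj (IsWSemigroup.zero_prec a)
  w1 x := by
    obtain ⟨a, rfl⟩ := P.proj_surjective x
    obtain ⟨s, h1, h2⟩ := exists_rapidSeq a
    refine ⟨fun n => P.proj (s.1 n), fun n => hP.proj_prec_proj (h1 n),
      fun n => hP.proj_prec_proj (s.2 n), fun y hy => ?_⟩
    obtain ⟨b, hb, hyb⟩ := hP.prec_proj_iff.1 hy
    obtain ⟨k, hk⟩ := h2 b hb
    exact ⟨k, hP.prec_of_le_of_prec hyb (hP.proj_prec_proj hk)⟩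
  w3 x x' y y' h h' := by
    obtain ⟨a, b, hx, hab, rfl⟩ := h
    obtain ⟨c, d, hy, hcd, rfl⟩ := h'
    exact ⟨a + c, b + d, by rw [map_add]; exact add_le_add hx hy, IsWSemigroup.w3 _ _ _ _ hab hcd,
      map_add _ _ _⟩
  w4 x y z h := by
    obtain ⟨b, rfl⟩ := P.proj_surjective y
    obtain ⟨c, rfl⟩ := P.proj_surjective z
    rw [← map_add] at h
    obtain ⟨a, ha, hx⟩ := hP.prec_proj_iff.1 h
    obtain ⟨b', c', h1, h2, h3⟩ := IsWSemigroup.w4 _ _ _ ha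
    exact ⟨P.proj b', P.proj c', ⟨a, b' + c', hx, h1, map_add _ _ _⟩, hP.proj_prec_proj h2,
      hP.proj_prec_proj h3⟩

end IsContinuous

/-- A preorder preserving additive map descends to the quotients. -/
def lift {T : Type*} [AddCommMonoid T] {P : MonoidPreorder S} {Q : MonoidPreorder T} (f : S →+ T)
    (h : ∀ a b, P.rel a b → Q.rel (f a) (f b)) : P.Quot →+ Q.Quot :=
  P.toAddCon.lift (Q.proj.comp f) fun a b hab =>
    Q.proj_eq_proj.2 ⟨h a b hab.1, h b a hab.2⟩

end MonoidPreorder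

/-! ### The preorder of a closed ideal -/

section Ideal

variable {S : Type*} [AddCommMonoid S] [HasPrec S] [IsWSemigroup S]

theorem idealPreorder_isContinuous (J : AddSubmonoid S) (hJ : IsClosedWIdeal J) :
    (idealPreorder J).IsContinuous where
  of_prec a b h x hx := ⟨0, J.zero_mem, by rw [add_zero]; exact IsWSemigroup.trans _ _ _ hx h⟩
  cont a b c hab hbc := by
    obtain ⟨y, hy, h⟩ := hbc a hab
    obtain ⟨c', y', h1, h2, h3⟩ := IsWSemigroup.w4 _ _ _ h
    exact ⟨c', h2, fun x hx => ⟨y', hJ.mem_of_prec _ _ h3 hy, IsWSemigroup.trans _ _ _ hx h1⟩⟩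

end Ideal

/-! ### The dynamical quotient of a W-semigroup -/

section Dynamical

variable {S : Type*} [AddCommMonoid S] [HasPrec S] [IsWSemigroup S] {G : Type*} [Group G]

theorem dynamicalPreorder_isDynamicalPreorder (η : G →* AddMonoid.End S) :
    IsDynamicalPreorder η (dynamicalPreorder η).rel where
  refl := (dynamicalPreorder η).refl
  trans := (dynamicalPreorder η).trans
  of_prec a b h _ hr := hr.of_prec a b h
  of_orbit g b _ hr := hr.of_orbit g b
  of_closure a b h r hr := hr.of_closure a b fun c hc => h c hc r hr
  add _ _ _ _ := (dynamicalPreorder η).add _ _ _ _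

theorem dynamicalPreorder_of_prec (η : G →* AddMonoid.End S) {a b : S} (h : a ≺ b) :
    (dynamicalPreorder η).rel a b :=
  (dynamicalPreorder_isDynamicalPreorder η).of_prec a b fun _ hc => IsWSemigroup.trans _ _ _ hc h

theorem dynamicalPreorder_isContinuous {η : G →* AddMonoid.End S} (hη : ∀ g, IsWMorphism (η g)) :
    (dynamicalPreorder η).IsContinuous where
  of_prec _ _ := dynamicalPreorder_of_prec η
  cont a b c hab hbc := by
    have hD := dynamicalPreorder_isDynamicalPreorder η
    -- The continuity condition, read as a relation between `b` and `c`, is itself a dynamical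
    -- preorder, so it contains the smallest one. In the orbit case the continuity of `η g` supplies
    -- `d`, and `η g d` is then replaced by `d`.
    refine hbc (fun b c => ∀ a, a ≺ b → ∃ d, d ≺ c ∧ (dynamicalPreorder η).rel a d)
      ⟨fun b a h => ⟨a, h, hD.refl a⟩, fun b c e h h' a hab => ?_,
        fun b c h a hab => ⟨a, h a hab, hD.refl a⟩, fun g b a hab => ?_, fun b c h a hab => ?_,
        fun b₁ b₂ c₁ c₂ h₁ h₂ a hab => ?_⟩ a hab
    · obtain ⟨d, hd, had⟩ := h a hab
      obtain ⟨d', hd', hdd'⟩ := h' d hd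
      exact ⟨d', hd', hD.trans _ _ _ had hdd'⟩
    · obtain ⟨d, hd, had⟩ := (hη g).cont _ _ hab
      exact ⟨d, hd, hD.trans _ _ _ (dynamicalPreorder_of_prec η had) (hD.of_orbit g d)⟩
    · obtain ⟨d, hd, had⟩ := exists_prec_between hab
      exact h d hd a had
    · obtain ⟨e₁, e₂, he, he₁, he₂⟩ := IsWSemigroup.w4 _ _ _ hab
      obtain ⟨d₁, hd₁, hed₁⟩ := h₁ e₁ he₁
      obtain ⟨d₂, hd₂, hed₂⟩ := h₂ e₂ he₂
      exact ⟨d₁ + d₂, IsWSemigroup.w3 _ _ _ _ hd₁ hd₂,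
        hD.trans _ _ _ (dynamicalPreorder_of_prec η he) (hD.add _ _ _ _ hed₁ hed₂)⟩

variable {T : Type*} [AddCommMonoid T] [HasPrec T] [IsWSemigroup T]

/-- Equivariant W-morphisms preserve the dynamical preorders. -/
theorem dynamicalPreorder_map {η : G →* AddMonoid.End S} {θ : G →* AddMonoid.End T} {f : S →+ T}
    (hf : IsWMorphism f) (he : ∀ g a, f (η g a) = θ g (f a)) (a b : S)
    (h : (dynamicalPreorder η).rel a b) : (dynamicalPreorder θ).rel (f a) (f b) := by
  have hD := dynamicalPreorder_isDynamicalPreorder θ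
  -- The pullback of `≤_G` along `f` is a dynamical preorder on `S`.
  refine h (fun a b => (dynamicalPreorder θ).rel (f a) (f b))
    ⟨fun a => hD.refl _, fun a b c => hD.trans _ _ _, fun a b h => hD.of_prec _ _ fun c hc => ?_,
      fun g b => ?_, fun a b h => hD.of_closure _ _ fun c hc => ?_, fun a₁ a₂ b₁ b₂ h₁ h₂ => ?_⟩
  · obtain ⟨a', ha', hc'⟩ := hf.cont _ _ hc
    exact IsWSemigroup.trans _ _ _ hc' (hf.mono _ _ (h a' ha'))
  · rw [he]
    exact hD.of_orbit g _
  · obtain ⟨a', ha', hc'⟩ := hf.cont _ _ hc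
    exact hD.trans _ _ _ (dynamicalPreorder_of_prec θ hc') (h a' ha')
  · rw [map_add, map_add]
    exact hD.add _ _ _ _ h₁ h₂

/-- The map of dynamical quotients induced by an equivariant W-morphism. -/
def DynQuot.map {η : G →* AddMonoid.End S} {θ : G →* AddMonoid.End T} {f : S →+ T}
    (hf : IsWMorphism f) (he : ∀ g a, f (η g a) = θ g (f a)) : DynQuot η →+ DynQuot θ :=
  MonoidPreorder.lift f (dynamicalPreorder_map hf he)

theorem DynQuot.map_isWMorphism {η : G →* AddMonoid.End S} {θ : G →* AddMonoid.End T} {f : S →+ T}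
    (hf : IsWMorphism f) (he : ∀ g a, f (η g a) = θ g (f a)) (hθ : ∀ g, IsWMorphism (θ g)) :
    IsWMorphism (DynQuot.map hf he) where
  mono x y := by
    rintro ⟨a, b, hx, hab, rfl⟩
    obtain ⟨c, rfl⟩ := MonoidPreorder.proj_surjective _ x
    exact ⟨f a, f b, dynamicalPreorder_map hf he _ _ hx, hf.mono _ _ hab, rfl⟩
  cont x y h := by
    obtain ⟨a, rfl⟩ := MonoidPreorder.proj_surjective _ x
    have hθ' := dynamicalPreorder_isContinuous hθ
    obtain ⟨c, hc, hyc⟩ := hθ'.prec_proj_iff.1 h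
    obtain ⟨a', ha', hca⟩ := hf.cont _ _ hc
    exact ⟨MonoidPreorder.proj _ a', ⟨a', a, le_rfl, ha', rfl⟩,
      hθ'.prec_of_le_of_prec hyc (hθ'.proj_prec_proj hca)⟩

/-! ### Closed ideals under the dynamical quotient -/

section Embedding

variable {η : G →* AddMonoid.End S} {θ : G →* AddMonoid.End T} {f : S →+ T}

/-- If `f` embeds `S` as an invariant closed ideal of `T`, then elements dynamically below the image
belong to the image, and `f` reflects the dynamical preorder. -/
theorem dynamicalPreorder_reflect (hf : ∀ a b, f a ≺ f b ↔ a ≺ b)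
    (he : ∀ g a, f (η g a) = θ g (f a)) (hJ : IsClosedWIdeal (AddMonoidHom.mrange f))
    {a : T} {b : S} (h : (dynamicalPreorder θ).rel a (f b)) :
    ∃ a', f a' = a ∧ ∀ a', f a' = a → (dynamicalPreorder η).rel a' b := by
  have hD := dynamicalPreorder_isDynamicalPreorder η
  -- Injectivity of `f` is not assumed. Reflecting `≺` only shows that two preimages have the same
  -- elements `≺` them, which is enough for `≤_G`.
  have heq : ∀ {a b : S}, f a = f b → (dynamicalPreorder η).rel a b := fun {a b} hab =>
    hD.of_prec _ _ fun c hc => by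
      rw [← hf, ← hab, hf]
      exact hc
  -- Membership in the range is part of the relation, propagating from right to left, because the
  -- intermediate terms of a chain are a priori arbitrary elements of `T`. Quantifying over all
  -- preimages makes the relation transitive and additive.
  have key := h (fun a b => b ∈ AddMonoidHom.mrange f → a ∈ AddMonoidHom.mrange f ∧
    ∀ a' b', f a' = a → f b' = b → (dynamicalPreorder η).rel a' b') ?_
  · obtain ⟨⟨a', ha'⟩, h'⟩ := key ⟨b, rfl⟩
    exact ⟨a', ha', fun a'' ha'' => h' a'' b ha'' rfl⟩
  · refine ⟨fun a ha => ⟨ha, fun a' b' h1 h2 => heq (h1.trans h2.symm)⟩, fun a b c h h' hc => ?_,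
      fun a b h hb => ?_, fun g b hb => ?_, fun a b h hb => ?_, fun a₁ a₂ b₁ b₂ h₁ h₂ hb => ?_⟩
    · obtain ⟨hb, h2⟩ := h' hc
      obtain ⟨ha, h1⟩ := h hb
      obtain ⟨b', hb'⟩ := hb
      exact ⟨ha, fun a' c' ha' hc' => hD.trans _ _ _ (h1 a' b' ha' hb') (h2 b' c' hb' hc')⟩
    · refine ⟨hJ.closed a fun c hc => hJ.mem_of_prec _ _ (h c hc) hb, fun a' b' ha' hb' => ?_⟩
      refine hD.of_prec _ _ fun c hc => ?_
      rw [← hf, hb']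
      apply h
      rwa [← ha', hf]
    · obtain ⟨b', rfl⟩ := hb
      refine ⟨⟨η g b', he g b'⟩, fun a' b'' ha' hb' => ?_⟩
      refine hD.trans _ _ _ (heq (ha'.trans (he g b').symm)) ?_
      exact hD.trans _ _ _ (hD.of_orbit g b') (heq hb'.symm)
    · refine ⟨hJ.closed a fun c hc => (h c hc hb).1, fun a' b' ha' hb' => ?_⟩
      refine hD.of_closure _ _ fun c hc => ?_
      exact (h (f c) (by rwa [← ha', hf]) hb).2 c b' rfl hb'
    · obtain ⟨⟨a₁', ha₁⟩, h₁'⟩ := h₁ (hJ.left_mem hb)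
      obtain ⟨⟨a₂', ha₂⟩, h₂'⟩ := h₂ (hJ.right_mem hb)
      obtain ⟨b₁', hb₁⟩ := hJ.left_mem hb
      obtain ⟨b₂', hb₂⟩ := hJ.right_mem hb
      have ha : f (a₁' + a₂') = a₁ + a₂ := by rw [map_add, ha₁, ha₂]
      have hb : f (b₁' + b₂') = b₁ + b₂ := by rw [map_add, hb₁, hb₂]
      refine ⟨⟨_, ha⟩, fun a' b' ha' hb' => ?_⟩
      exact hD.trans _ _ _ (heq (ha'.trans ha.symm)) (hD.trans _ _ _
        (hD.add _ _ _ _ (h₁' _ _ ha₁ hb₁) (h₂' _ _ ha₂ hb₂)) (heq (hb.trans hb'.symm)))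

variable (hf : ∀ a b, f a ≺ f b ↔ a ≺ b) (hw : IsWMorphism f)
  (he : ∀ g a, f (η g a) = θ g (f a)) (hJ : IsClosedWIdeal (AddMonoidHom.mrange f))
include hf hJ

theorem DynQuot.map_le_map_iff (x y : DynQuot η) :
    DynQuot.map hw he x ≤ DynQuot.map hw he y ↔ x ≤ y := by
  obtain ⟨a, rfl⟩ := MonoidPreorder.proj_surjective _ x
  obtain ⟨b, rfl⟩ := MonoidPreorder.proj_surjective _ y
  refine ⟨fun h => ?_, dynamicalPreorder_map hw he a b⟩
  obtain ⟨_, _, h⟩ := dynamicalPreorder_reflect hf he hJ h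
  exact h a rfl

theorem DynQuot.map_prec_map_iff (hη : ∀ g, IsWMorphism (η g)) (hθ : ∀ g, IsWMorphism (θ g))
    (x y : DynQuot η) : DynQuot.map hw he x ≺ DynQuot.map hw he y ↔ x ≺ y := by
  refine ⟨fun h => ?_, (DynQuot.map_isWMorphism hw he hθ).mono x y⟩
  -- Only `≤` is known to be reflected so far. Continuity leaves room below `y` to weaken `≺` to
  -- `≤`, reflect it, and recover `≺` from `y' ≺ y`.
  obtain ⟨y', hy', h⟩ := (DynQuot.map_isWMorphism hw he hθ).cont _ _ h
  have h' := (dynamicalPreorder_isContinuous hθ).le_of_prec h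
  rw [DynQuot.map_le_map_iff hf hw he hJ] at h'
  exact (dynamicalPreorder_isContinuous hη).prec_of_le_of_prec h' hy'

theorem DynQuot.map_range_isClosedWIdeal (hθ : ∀ g, IsWMorphism (θ g)) :
    IsClosedWIdeal (AddMonoidHom.mrange (DynQuot.map hw he)) where
  mem_of_prec x y h hy := by
    obtain ⟨y, rfl⟩ := hy
    obtain ⟨a, rfl⟩ := MonoidPreorder.proj_surjective _ x
    obtain ⟨b, rfl⟩ := MonoidPreorder.proj_surjective _ y
    obtain ⟨a', rfl, -⟩ := dynamicalPreorder_reflect hf he hJ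
      ((dynamicalPreorder_isContinuous hθ).le_of_prec h)
    exact ⟨MonoidPreorder.proj _ a', rfl⟩
  closed x h := by
    obtain ⟨a, rfl⟩ := MonoidPreorder.proj_surjective _ x
    obtain ⟨a', rfl⟩ := hJ.closed a fun c hc => by
      obtain ⟨y, hy⟩ := h (MonoidPreorder.proj _ c) ⟨c, a, le_rfl, hc, rfl⟩
      obtain ⟨b, rfl⟩ := MonoidPreorder.proj_surjective _ y
      obtain ⟨c', hc', -⟩ := dynamicalPreorder_reflect hf he hJ
        (MonoidPreorder.proj_le_proj _ |>.1 hy.ge)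
      exact ⟨c', hc'⟩
    exact ⟨MonoidPreorder.proj _ a', rfl⟩

end Embedding

/-! ### Quotient maps under the dynamical quotient -/

section Quotient

variable {η : G →* AddMonoid.End S} {θ : G →* AddMonoid.End T} {f : S →+ T}

/-- Let `f : S → T` be surjective, with `x ≤_J y` whenever `f x` is below `f y`. Then the induced
map of dynamical quotients has the same property for any ideal containing the image of `J`. -/
theorem dynamicalPreorder_quotient [IsWSemigroup (DynQuot η)] (hη : ∀ g, IsWMorphism (η g))
    (he : ∀ g a, f (η g a) = θ g (f a)) (hs : Function.Surjective f) (J : AddSubmonoid S)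
    (hJ : ∀ a b, (∀ c, c ≺ f a → c ≺ f b) → (idealPreorder J).rel a b)
    (K : AddSubmonoid (DynQuot η)) (hJK : ∀ a ∈ J, MonoidPreorder.proj _ a ∈ K)
    (hw : IsWMorphism f)
    {a b : S} (h : (dynamicalPreorder θ).rel (f a) (f b)) :
    (idealPreorder K).rel (MonoidPreorder.proj _ a) (MonoidPreorder.proj _ b) := by
  have hc := dynamicalPreorder_isContinuous hη
  have hD := dynamicalPreorder_isDynamicalPreorder η
  have base : ∀ a b, (∀ c, c ≺ f a → c ≺ f b) →
      (idealPreorder K).rel (MonoidPreorder.proj _ a) (MonoidPreorder.proj _ b) := by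
    intro a b hab x hx
    obtain ⟨a', ha', hxa⟩ := hc.prec_proj_iff.1 hx
    obtain ⟨y, hy, h⟩ := hJ a b hab a' ha'
    refine ⟨MonoidPreorder.proj _ y, hJK y hy, ?_⟩
    rw [← map_add]
    exact hc.prec_of_le_of_prec hxa (hc.proj_prec_proj h)
  have heq : ∀ {a b}, f a = f b →
      (idealPreorder K).rel (MonoidPreorder.proj _ a) (MonoidPreorder.proj _ b) :=
    fun {a b} hab => base a b fun c hc => hab ▸ hc
  -- Comparison modulo `K` of all lifts is a dynamical preorder on `T`. By `heq` the choice of lifts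
  -- does not matter, and surjectivity of `f` supplies lifts of intermediate terms and of summands.
  refine h (fun u v => ∀ a b, f a = u → f b = v →
    (idealPreorder K).rel (MonoidPreorder.proj _ a) (MonoidPreorder.proj _ b))
    ⟨fun u a b ha hb => heq (ha.trans hb.symm), fun u v w h h' a c ha hc => ?_, ?_, ?_, ?_, ?_⟩ a b
    rfl rfl
  · obtain ⟨b, hb⟩ := hs v
    exact (idealPreorder K).trans _ _ _ (h a b ha hb) (h' b c hb hc)
  · rintro _ _ h a b rfl rfl
    exact base a b h
  · rintro g _ a b ha rfl
    rw [← he] at ha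
    refine (idealPreorder K).trans _ _ _ (heq ha) fun x hx => ⟨0, K.zero_mem, ?_⟩
    rw [add_zero]
    exact hc.prec_of_prec_of_le hx (hD.of_orbit g b)
  · rintro _ _ h a b rfl rfl x hx
    -- The interpolated `z` gives `x ≺ [a']`, not merely `x ≤ [a']`, as the definition of `≤_K`
    -- requires.
    obtain ⟨z, hz, hxz⟩ := exists_prec_between hx
    obtain ⟨a', ha', hza⟩ := hc.prec_proj_iff.1 hz
    exact h (f a') (hw.mono _ _ ha') a' b rfl rfl x (hc.prec_of_prec_of_le hxz hza)
  · rintro u₁ u₂ v₁ v₂ h₁ h₂ a b ha hb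
    obtain ⟨a₁, ha₁⟩ := hs u₁
    obtain ⟨a₂, ha₂⟩ := hs u₂
    obtain ⟨b₁, hb₁⟩ := hs v₁
    obtain ⟨b₂, hb₂⟩ := hs v₂
    have ha' : f a = f (a₁ + a₂) := by rw [ha, map_add, ha₁, ha₂]
    have hb' : f (b₁ + b₂) = f b := by rw [hb, map_add, hb₁, hb₂]
    refine (idealPreorder K).trans _ _ _ (heq ha') ((idealPreorder K).trans _ _ _ ?_ (heq hb'))
    rw [map_add, map_add]
    exact (idealPreorder K).add _ _ _ _ (h₁ a₁ b₁ ha₁ hb₁) (h₂ a₂ b₂ ha₂ hb₂)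

/-- This is where condition (iii) in the definition of `≤_G` is used: the quotient order is
determined by what lies `≺` an element. -/
theorem DynQuot.le_of_forall_prec {x y : DynQuot η} (h : ∀ z, z ≺ x → z ≤ y) : x ≤ y := by
  obtain ⟨a, rfl⟩ := MonoidPreorder.proj_surjective _ x
  obtain ⟨b, rfl⟩ := MonoidPreorder.proj_surjective _ y
  exact (dynamicalPreorder_isDynamicalPreorder η).of_closure a b fun c hc =>
    h (MonoidPreorder.proj _ c) ⟨c, a, le_rfl, hc, rfl⟩

theorem DynQuot.map_surjective (hw : IsWMorphism f) (he : ∀ g a, f (η g a) = θ g (f a))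
    (hs : Function.Surjective f) : Function.Surjective (DynQuot.map hw he) := by
  intro y
  obtain ⟨b, rfl⟩ := MonoidPreorder.proj_surjective _ y
  obtain ⟨a, rfl⟩ := hs b
  exact ⟨MonoidPreorder.proj _ a, rfl⟩

/-- The order of the target is the pushforward of `≤_K`; this is the whole content of the
isomorphism for the quotient. One direction uses that `K` is sent to zero, the other is
`dynamicalPreorder_quotient`. -/
theorem DynQuot.idealPreorder_rel_iff [IsWSemigroup (DynQuot η)] (hη : ∀ g, IsWMorphism (η g))
    (hθ : ∀ g, IsWMorphism (θ g)) (hw : IsWMorphism f) (he : ∀ g a, f (η g a) = θ g (f a))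
    (hs : Function.Surjective f) (J : AddSubmonoid S)
    (hJ : ∀ a b, (∀ c, c ≺ f a → c ≺ f b) → (idealPreorder J).rel a b)
    (K : AddSubmonoid (DynQuot η)) (hJK : ∀ a ∈ J, MonoidPreorder.proj _ a ∈ K)
    (hK : ∀ x ∈ K, DynQuot.map hw he x = 0) (x y : DynQuot η) :
    (idealPreorder K).rel x y ↔ DynQuot.map hw he x ≤ DynQuot.map hw he y := by
  have hp := DynQuot.map_isWMorphism hw he hθ
  constructor
  · refine fun h => DynQuot.le_of_forall_prec fun z hz => ?_
    obtain ⟨x', hx', hzx⟩ := hp.cont _ _ hz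
    obtain ⟨k, hk, h'⟩ := h x' hx'
    have h2 := hp.mono _ _ h'
    rw [map_add, hK k hk, add_zero] at h2
    have hc := dynamicalPreorder_isContinuous hθ
    exact (hc.le_of_prec hzx).trans (hc.le_of_prec h2)
  · intro h
    obtain ⟨a, rfl⟩ := MonoidPreorder.proj_surjective _ x
    obtain ⟨b, rfl⟩ := MonoidPreorder.proj_surjective _ y
    exact dynamicalPreorder_quotient hη he hs J hJ K hJK hw h

end Quotient

end Dynamical

/-! ### Isomorphisms out of a quotient by a preorder -/

section QuotientIso

namespace MonoidPreorder

variable {S T : Type*} [AddCommMonoid S] [AddCommMonoid T] [PartialOrder T]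

/-- The quotient by a preorder that is the pullback of a partial order along a surjection. -/
noncomputable def quotEquiv (P : MonoidPreorder S) (p : S →+ T) (hs : Function.Surjective p)
    (h : ∀ a b, P.rel a b ↔ p a ≤ p b) : P.Quot ≃+o T where
  __ := AddEquiv.ofBijective (P.toAddCon.lift p fun a b hab =>
      le_antisymm ((h a b).1 hab.1) ((h b a).1 hab.2)) <| by
    refine ⟨fun x y hxy => ?_, fun z => ?_⟩
    · obtain ⟨a, rfl⟩ := P.proj_surjective x
      obtain ⟨b, rfl⟩ := P.proj_surjective y
      change p a = p b at hxy
      exact P.proj_eq_proj.2 ⟨(h a b).2 hxy.le, (h b a).2 hxy.ge⟩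
    · obtain ⟨a, rfl⟩ := hs z
      exact ⟨P.proj a, rfl⟩
  map_le_map_iff' {x y} := by
    obtain ⟨a, rfl⟩ := P.proj_surjective x
    obtain ⟨b, rfl⟩ := P.proj_surjective y
    exact (h a b).symm

theorem quotEquiv_proj (P : MonoidPreorder S) (p : S →+ T) (hs : Function.Surjective p)
    (h : ∀ a b, P.rel a b ↔ p a ≤ p b) (a : S) : P.quotEquiv p hs h (P.proj a) = p a := rfl

/-- On both sides `≺` is recovered from `≤` in the same way: an element is `≺` the class of `b`
exactly when it is `≤` the class of some `b' ≺ b`. -/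
theorem quotEquiv_prec_iff [HasPrec S] [HasPrec T] (P : MonoidPreorder S) (hP : P.IsContinuous)
    (p : S →+ T) (hs : Function.Surjective p) (h : ∀ a b, P.rel a b ↔ p a ≤ p b)
    (hp : IsWMorphism p) (hT : ∀ x y : T, x ≺ y → x ≤ y)
    (hT' : ∀ x y z : T, x ≤ y → y ≺ z → x ≺ z) (x y : P.Quot) :
    P.quotEquiv p hs h x ≺ P.quotEquiv p hs h y ↔ x ≺ y := by
  obtain ⟨a, rfl⟩ := P.proj_surjective x
  obtain ⟨b, rfl⟩ := P.proj_surjective y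
  rw [quotEquiv_proj, quotEquiv_proj, hP.prec_proj_iff]
  constructor
  · intro hab
    obtain ⟨b', hb', hab'⟩ := hp.cont _ _ hab
    exact ⟨b', hb', (h _ _).2 (hT _ _ hab')⟩
  · rintro ⟨b', hb', hab'⟩
    exact hT' _ _ _ ((h _ _).1 hab') (hp.mono _ _ hb')

end MonoidPreorder

end QuotientIso

/-! ### The completion as round lower sets -/

section Completion

variable {S : Type*} [AddCommMonoid S] [HasPrec S] [IsWSemigroup S]

namespace CuCompletion

/-- The elements of `S` that lie below an element of the completion. -/
def Mem (a : S) (x : CuCompletion S) : Prop := ∃ s, (rapidPreorder S).proj s = x ∧ ∃ m, a ≺ s.1 m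

theorem mem_proj {a : S} {s : RapidSeq S} : Mem a ((rapidPreorder S).proj s) ↔ ∃ m, a ≺ s.1 m := by
  constructor
  · rintro ⟨t, ht, m, hm⟩
    obtain ⟨l, hl⟩ := ((rapidPreorder S).proj_eq_proj.1 ht).1 m
    exact ⟨l, IsWSemigroup.trans _ _ _ hm hl⟩
  · exact fun h => ⟨s, rfl, h⟩

/-- An element of the completion is determined by its lower set in `S`. From here on order and
suprema are computed as inclusion and union, without choosing representing sequences. -/
theorem le_iff {x y : CuCompletion S} : x ≤ y ↔ ∀ a, Mem a x → Mem a y := by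
  obtain ⟨s, rfl⟩ := MonoidPreorder.proj_surjective _ x
  obtain ⟨t, rfl⟩ := MonoidPreorder.proj_surjective _ y
  simp only [mem_proj]
  constructor
  · rintro h a ⟨m, hm⟩
    obtain ⟨l, hl⟩ := h m
    exact ⟨l, IsWSemigroup.trans _ _ _ hm hl⟩
  · exact fun h n => h _ ⟨n + 1, s.2 n⟩

theorem ext_mem {x y : CuCompletion S} (h : ∀ a, Mem a x ↔ Mem a y) : x = y :=
  le_antisymm (le_iff.2 fun a => (h a).1) (le_iff.2 fun a => (h a).2)

theorem Mem.of_prec {a b : S} {x : CuCompletion S} (hb : Mem b x) (h : a ≺ b) : Mem a x := by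
  obtain ⟨s, hs, m, hm⟩ := hb
  exact ⟨s, hs, m, IsWSemigroup.trans _ _ _ h hm⟩

theorem Mem.directed {a b : S} {x : CuCompletion S} (ha : Mem a x) (hb : Mem b x) :
    ∃ c, Mem c x ∧ a ≺ c ∧ b ≺ c := by
  obtain ⟨s, rfl⟩ := MonoidPreorder.proj_surjective _ x
  rw [mem_proj] at ha hb
  obtain ⟨m, hm⟩ := ha
  obtain ⟨l, hl⟩ := hb
  exact ⟨s.1 (max m l), mem_proj.2 ⟨_, s.2 _⟩, s.prec_of_le hm (le_max_left _ _),
    s.prec_of_le hl (le_max_right _ _)⟩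

theorem Mem.exists_prec {a : S} {x : CuCompletion S} (ha : Mem a x) : ∃ c, Mem c x ∧ a ≺ c := by
  obtain ⟨c, hc, h, -⟩ := ha.directed ha
  exact ⟨c, hc, h⟩

theorem mem_zero_left (x : CuCompletion S) : Mem (0 : S) x := by
  obtain ⟨s, rfl⟩ := MonoidPreorder.proj_surjective _ x
  exact mem_proj.2 ⟨0, IsWSemigroup.zero_prec _⟩

theorem mem_add {a : S} {x y : CuCompletion S} :
    Mem a (x + y) ↔ ∃ b c, Mem b x ∧ Mem c y ∧ a ≺ b + c := by
  obtain ⟨s, rfl⟩ := MonoidPreorder.proj_surjective _ x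
  obtain ⟨t, rfl⟩ := MonoidPreorder.proj_surjective _ y
  rw [← map_add]
  simp only [mem_proj]
  constructor
  · rintro ⟨m, hm⟩
    exact ⟨s.1 m, t.1 m, ⟨_, s.2 m⟩, ⟨_, t.2 m⟩, hm⟩
  · rintro ⟨b, c, ⟨m, hm⟩, ⟨l, hl⟩, h⟩
    exact ⟨max m l, IsWSemigroup.trans _ _ _ h (IsWSemigroup.w3 _ _ _ _
      (s.prec_of_le hm (le_max_left _ _)) (t.prec_of_le hl (le_max_right _ _)))⟩

theorem mem_zero {a : S} : Mem a (0 : CuCompletion S) ↔ a ≺ 0 := by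
  rw [← map_zero (rapidPreorder S).proj, mem_proj]
  exact ⟨fun ⟨_, h⟩ => h, fun h => ⟨0, h⟩⟩

/-- A countably generated round ideal of `S` is the set of elements below some element of the
completion. -/
theorem exists_mem_iff (U : S → Prop) (h0 : U 0) (hd : ∀ a b, U a → U b → ∃ c, U c ∧ a ≺ c ∧ b ≺ c)
    (hl : ∀ a b, a ≺ b → U b → U a) (u : ℕ → S) (hu : ∀ n, U (u n))
    (hu' : ∀ a, U a → ∃ n, a ≺ u n) : ∃ x : CuCompletion S, ∀ a, Mem a x ↔ U a := by
  choose c hc h1 h2 using hd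
  -- The generators `u n` need not increase. Starting at `0`, directedness gives a `t (n + 1)` with
  -- both `t n` and `u n` strictly below it, so `t` is rapidly increasing and cofinal.
  let t : ℕ → {a : S // U a} := fun n => Nat.rec ⟨0, h0⟩
    (fun k a => ⟨c a.1 (u k) a.2 (hu k), hc _ _ _ _⟩) n
  have ht : ∀ n, (t (n + 1)).1 = c (t n).1 (u n) (t n).2 (hu n) := fun n => rfl
  have hr : ∀ n, (t n).1 ≺ (t (n + 1)).1 := fun n => by
    rw [ht]
    exact h1 _ _ _ _
  obtain ⟨r, hr⟩ : ∃ r : RapidSeq S, ∀ n, r.1 n = (t n).1 := ⟨⟨_, hr⟩, fun _ => rfl⟩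
  refine ⟨(rapidPreorder S).proj r, fun a => ?_⟩
  · simp only [mem_proj, hr]
    constructor
    · rintro ⟨m, hm⟩
      exact hl _ _ hm (t m).2
    · intro ha
      obtain ⟨n, hn⟩ := hu' a ha
      refine ⟨n + 1, IsWSemigroup.trans _ _ _ hn ?_⟩
      rw [ht]
      exact h2 _ _ _ _

/-- The union of the lower sets is directed because `s` is monotone, and it is generated by the
terms of all representing sequences, enumerated by `Nat.unpair`. -/
theorem exists_mem_iff_exists (s : ℕ → CuCompletion S) (hs : Monotone s) :
    ∃ x : CuCompletion S, ∀ a, Mem a x ↔ ∃ n, Mem a (s n) := by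
  choose σ hσ using fun n => MonoidPreorder.proj_surjective _ (s n)
  refine exists_mem_iff _ ⟨0, mem_zero_left _⟩ ?_ ?_
    (fun n => (σ n.unpair.1).1 n.unpair.2) ?_ ?_
  · rintro a b ⟨m, hm⟩ ⟨l, hl⟩
    obtain ⟨c, hc, h⟩ := (le_iff.1 (hs (le_max_left m l)) _ hm).directed
      (le_iff.1 (hs (le_max_right m l)) _ hl)
    exact ⟨c, ⟨_, hc⟩, h⟩
  · rintro a b hab ⟨n, hn⟩
    exact ⟨n, hn.of_prec hab⟩
  · intro n
    refine ⟨n.unpair.1, ?_⟩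
    rw [← hσ, mem_proj]
    exact ⟨_, (σ _).2 _⟩
  · rintro a ⟨n, hn⟩
    rw [← hσ, mem_proj] at hn
    obtain ⟨m, hm⟩ := hn
    exact ⟨Nat.pair n m, by simpa using hm⟩

/-- The union is a lower set of the completion and is a supremum; uniqueness of suprema gives the
converse. -/
theorem isLUB_iff {s : ℕ → CuCompletion S} (hs : Monotone s) {x : CuCompletion S} :
    IsLUB (Set.range s) x ↔ ∀ a, Mem a x ↔ ∃ n, Mem a (s n) := by
  have key : ∀ y : CuCompletion S, (∀ a, Mem a y ↔ ∃ n, Mem a (s n)) → IsLUB (Set.range s) y := by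
    refine fun y hy => ⟨?_, fun z hz => le_iff.2 fun a ha => ?_⟩
    · rintro _ ⟨n, rfl⟩
      exact le_iff.2 fun a ha => (hy a).2 ⟨n, ha⟩
    · obtain ⟨n, hn⟩ := (hy a).1 ha
      exact le_iff.1 (hz ⟨n, rfl⟩) a hn
  refine ⟨fun h => ?_, key x⟩
  obtain ⟨y, hy⟩ := exists_mem_iff_exists s hs
  rwa [h.unique (key y hy)]

/-- The image of an element of `S` in the completion. -/
noncomputable def of (a : S) : CuCompletion S :=
  (rapidPreorder S).proj (exists_rapidSeq a).choose

theorem mem_of {a b : S} : Mem a (of b) ↔ a ≺ b := by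
  rw [of, mem_proj]
  obtain ⟨h1, h2⟩ := (exists_rapidSeq b).choose_spec
  exact ⟨fun ⟨m, hm⟩ => IsWSemigroup.trans _ _ _ hm (h1 m), h2 a⟩

theorem of_monotone (s : RapidSeq S) : Monotone fun n => of (s.1 n) :=
  monotone_nat_of_le_succ fun n => le_iff.2 fun a ha => by
    rw [mem_of] at ha ⊢
    exact IsWSemigroup.trans _ _ _ ha (s.2 n)

theorem isLUB_of (s : RapidSeq S) :
    IsLUB (Set.range fun n => of (s.1 n)) ((rapidPreorder S).proj s) := by
  rw [isLUB_iff (of_monotone s)]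
  simp only [mem_proj, mem_of, implies_true]

/-- Testing compact containment on the sequence `of (t n)`, whose supremum is `y`, produces one
element of `S` that separates `x` from `y`. -/
theorem wayBelow_iff {x y : CuCompletion S} : WayBelow x y ↔ ∃ b, Mem b y ∧ ∀ a, Mem a x → a ≺ b := by
  constructor
  · intro h
    obtain ⟨t, rfl⟩ := MonoidPreorder.proj_surjective _ y
    obtain ⟨n, hn⟩ := h _ _ (of_monotone t) (isLUB_of t) le_rfl
    exact ⟨t.1 n, mem_proj.2 ⟨_, t.2 n⟩, fun a ha => mem_of.1 (le_iff.1 hn a ha)⟩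
  · rintro ⟨b, hb, h⟩ s c hs hc hyc
    obtain ⟨n, hn⟩ := ((isLUB_iff hs).1 hc b).1 (le_iff.1 hyc b hb)
    exact ⟨n, le_iff.2 fun a ha => hn.of_prec (h a ha)⟩

theorem of_wayBelow_of {a b : S} (h : a ≺ b) : WayBelow (of a) (of b) :=
  wayBelow_iff.2 ⟨a, mem_of.2 h, fun _ hc => mem_of.1 hc⟩

instance isCuSemigroup : IsCuSemigroup (CuCompletion S) where
  zero_le x := le_iff.2 fun a ha => (mem_zero_left x).of_prec (mem_zero.1 ha)
  add_le_add _ _ _ _ := add_le_add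
  o1 s hs := by
    obtain ⟨x, hx⟩ := exists_mem_iff_exists s hs
    exact ⟨x, (isLUB_iff hs).2 hx⟩
  o2 x := by
    obtain ⟨s, rfl⟩ := MonoidPreorder.proj_surjective _ x
    exact ⟨_, fun n => of_wayBelow_of (s.2 n), isLUB_of s⟩
  o3 x' x y' y hx hy := by
    rw [wayBelow_iff] at hx hy ⊢
    obtain ⟨b, hb, hb'⟩ := hx
    obtain ⟨c, hc, hc'⟩ := hy
    -- The bound `b + c` has to be strictly below a sum of members to belong to `x + y`, hence the
    -- larger `d` and `e`.
    obtain ⟨d, hd, hbd⟩ := hb.exists_prec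
    obtain ⟨e, he, hce⟩ := hc.exists_prec
    refine ⟨b + c, mem_add.2 ⟨d, e, hd, he, IsWSemigroup.w3 _ _ _ _ hbd hce⟩, fun a ha => ?_⟩
    obtain ⟨f, g, hf, hg, ha⟩ := mem_add.1 ha
    exact IsWSemigroup.trans _ _ _ ha (IsWSemigroup.w3 _ _ _ _ (hb' f hf) (hc' g hg))
  o4 _ _ _ _ hs ht hx hy := by
    rw [isLUB_iff hs] at hx
    rw [isLUB_iff ht] at hy
    rw [isLUB_iff (hs.add ht)]
    intro a
    simp only [mem_add]
    constructor
    · rintro ⟨b, c, hb, hc, h⟩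
      obtain ⟨m, hm⟩ := (hx b).1 hb
      obtain ⟨l, hl⟩ := (hy c).1 hc
      exact ⟨max m l, b, c, le_iff.1 (hs (le_max_left m l)) _ hm,
        le_iff.1 (ht (le_max_right m l)) _ hl, h⟩
    · rintro ⟨n, b, c, hb, hc, h⟩
      exact ⟨b, c, (hx b).2 ⟨n, hb⟩, (hy c).2 ⟨n, hc⟩, h⟩

variable {T : Type*} [AddCommMonoid T] [HasPrec T] [IsWSemigroup T]

/-- Termwise application of a map preserving `≺`. -/
def _root_.DynCuntz.RapidSeq.map (f : S →+ T) (hf : ∀ a b, a ≺ b → f a ≺ f b) :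
    RapidSeq S →+ RapidSeq T where
  toFun s := ⟨fun n => f (s.1 n), fun n => hf _ _ (s.2 n)⟩
  map_zero' := Subtype.ext (funext fun _ => map_zero f)
  map_add' s t := Subtype.ext (funext fun n => map_add f (s.1 n) (t.1 n))

/-- The map of completions induced by an additive map preserving `≺`. -/
def map (f : S →+ T) (hf : ∀ a b, a ≺ b → f a ≺ f b) : CuCompletion S →+ CuCompletion T :=
  ((rapidPreorder S).toAddCon.lift ((rapidPreorder T).proj.comp (RapidSeq.map f hf))) fun _ _ h =>
    (rapidPreorder T).proj_eq_proj.2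
      ⟨fun n => (h.1 n).imp fun _ => hf _ _, fun n => (h.2 n).imp fun _ => hf _ _⟩

theorem map_proj {f : S →+ T} (hf : ∀ a b, a ≺ b → f a ≺ f b) (s : RapidSeq S) :
    map f hf ((rapidPreorder S).proj s) = (rapidPreorder T).proj (RapidSeq.map f hf s) := rfl

theorem map_proj_eq {f : S →+ T} (hf : ∀ a b, a ≺ b → f a ≺ f b) {s : RapidSeq S} {t : RapidSeq T}
    (h : ∀ n, t.1 n = f (s.1 n)) :
    map f hf ((rapidPreorder S).proj s) = (rapidPreorder T).proj t := by
  rw [map_proj]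
  congr 1
  exact Subtype.ext (funext fun n => (h n).symm)

theorem mem_map {f : S →+ T} (hf : ∀ a b, a ≺ b → f a ≺ f b) {b : T} {x : CuCompletion S} :
    Mem b (map f hf x) ↔ ∃ a, Mem a x ∧ b ≺ f a := by
  obtain ⟨s, rfl⟩ := MonoidPreorder.proj_surjective _ x
  rw [map_proj, mem_proj]
  constructor
  · rintro ⟨m, hm⟩
    exact ⟨s.1 m, mem_proj.2 ⟨_, s.2 m⟩, hm⟩
  · rintro ⟨a, ha, hb⟩
    obtain ⟨m, hm⟩ := mem_proj.1 ha
    exact ⟨m, IsWSemigroup.trans _ _ _ hb (hf _ _ hm)⟩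

/-! ### Ideals of the completion -/

section Embedding

variable {f : S →+ T} (hf : ∀ a b, f a ≺ f b ↔ a ≺ b)
include hf

theorem map_le_map_iff (x y : CuCompletion S) :
    map f (fun a b => (hf a b).2) x ≤ map f (fun a b => (hf a b).2) y ↔ x ≤ y := by
  obtain ⟨s, rfl⟩ := MonoidPreorder.proj_surjective _ x
  obtain ⟨t, rfl⟩ := MonoidPreorder.proj_surjective _ y
  exact forall_congr' fun n => exists_congr fun m => hf _ _

variable (hJ : IsClosedWIdeal (AddMonoidHom.mrange f))
include hJ

/-- The image is described by lower sets contained in the range of `f`, which makes both ideal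
axioms immediate. A representing sequence in the range lifts termwise, since `f` reflects `≺`. -/
theorem mem_map_range {y : CuCompletion T} :
    y ∈ AddMonoidHom.mrange (map f fun a b => (hf a b).2) ↔
      ∀ b, Mem b y → b ∈ AddMonoidHom.mrange f := by
  constructor
  · rintro ⟨x, rfl⟩ b hb
    obtain ⟨a, -, hba⟩ := (mem_map _).1 hb
    exact hJ.mem_of_prec _ _ hba ⟨a, rfl⟩
  · intro h
    obtain ⟨t, rfl⟩ := MonoidPreorder.proj_surjective _ y
    choose s hs using fun n => h (t.1 n) (mem_proj.2 ⟨_, t.2 n⟩)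
    refine ⟨(rapidPreorder S).proj ⟨s, fun n => ?_⟩, ?_⟩
    · rw [← hf, hs, hs]
      exact t.2 n
    · exact map_proj_eq _ fun n => (hs n).symm

theorem map_range_isCuIdeal :
    IsCuIdeal (AddMonoidHom.mrange (map f fun a b => (hf a b).2)) where
  mem_of_le x y h hy := by
    rw [mem_map_range hf hJ] at hy ⊢
    exact fun b hb => hy b (le_iff.1 h b hb)
  sup_mem _ _ hs hK hx := by
    rw [mem_map_range hf hJ]
    intro b hb
    obtain ⟨n, hn⟩ := ((isLUB_iff hs).1 hx b).1 hb
    exact (mem_map_range hf hJ).1 (hK n) b hn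

end Embedding

/-! ### Quotients of the completion -/

section Quotient

variable {p : S →+ T} (hp : IsWMorphism p) (hs : Function.Surjective p) {J : AddSubmonoid S}
  (hpJ : ∀ a b, p a ≺ p b → (idealPreorder J).rel a b)
include hp hpJ hs

/-- Rapidly increasing sequences lift along quotient maps, up to equivalence. -/
theorem map_surjective_of_quotient (h0 : ∀ a ∈ J, p a = 0) :
    Function.Surjective (map p hp.mono) := by
  intro y
  obtain ⟨u, rfl⟩ := MonoidPreorder.proj_surjective _ y
  choose a ha using fun n => hs (u.1 n)
  -- Carry a lift `b` of `u n` and some `c ≺ b`. The next lift is `a (n + 1) + y`, with `y ∈ J`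
  -- making room for `c`; below it one finds `c'` above `c` with image above `u n`. The `c`'s form
  -- the lifted sequence, with images interlaced with `u`.
  have step : ∀ n, ∀ b c : S, c ≺ b → p b = u.1 n → ∃ b' c', c' ≺ b' ∧ p b' = u.1 (n + 1) ∧
      c ≺ c' ∧ u.1 n ≺ p c' := by
    intro n b c hcb hb
    have hab : p b ≺ p (a (n + 1)) := by
      rw [hb, ha]
      exact u.2 n
    obtain ⟨y, hy, hcy⟩ := hpJ _ _ hab c hcb
    have hp1 : p (a (n + 1) + y) = u.1 (n + 1) := by rw [map_add, h0 y hy, add_zero, ha]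
    obtain ⟨c', hc', h⟩ := hp.cont (a (n + 1) + y) (u.1 n) (by rw [hp1]; exact u.2 n)
    obtain ⟨d, hd, hcd, hc'd⟩ := exists_prec_prec hcy hc'
    exact ⟨_, d, hd, hp1, hcd, IsWSemigroup.trans _ _ _ h (hp.mono _ _ hc'd)⟩
  choose B C h1 h2 h3 h4 using step
  let t : ∀ n : ℕ, {x : S × S // x.2 ≺ x.1 ∧ p x.1 = u.1 n} := fun n =>
    Nat.rec ⟨(a 0, 0), IsWSemigroup.zero_prec _, ha 0⟩
      (fun k x => ⟨(B k x.1.1 x.1.2 x.2.1 x.2.2, C k x.1.1 x.1.2 x.2.1 x.2.2),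
        h1 _ _ _ _ _, h2 _ _ _ _ _⟩) n
  have ht : ∀ n, (t (n + 1)).1.2 = C n (t n).1.1 (t n).1.2 (t n).2.1 (t n).2.2 := fun n => rfl
  have hr : ∀ n, (t n).1.2 ≺ (t (n + 1)).1.2 := fun n => by
    rw [ht]
    exact h3 _ _ _ _ _
  obtain ⟨r, hr⟩ : ∃ r : RapidSeq S, ∀ n, r.1 n = (t n).1.2 := ⟨⟨_, hr⟩, fun _ => rfl⟩
  refine ⟨(rapidPreorder S).proj r, ext_mem fun b => ?_⟩
  · rw [map_proj, mem_proj, mem_proj]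
    change (∃ m, b ≺ p (r.1 m)) ↔ _
    simp only [hr]
    constructor
    · rintro ⟨m, hm⟩
      refine ⟨m, IsWSemigroup.trans _ _ _ hm ?_⟩
      have := hp.mono _ _ (t m).2.1
      rwa [(t m).2.2] at this
    · rintro ⟨m, hm⟩
      refine ⟨m + 1, IsWSemigroup.trans _ _ _ hm ?_⟩
      rw [ht]
      exact h4 _ _ _ _ _

theorem cuIdealPreorder_rel_iff (h0 : ∀ a ∈ J, p a = 0) (hJ : IsClosedWIdeal J)
    {K : AddSubmonoid (CuCompletion S)}
    (hK : ∀ x, x ∈ K ↔ ∀ a, Mem a x → a ∈ J) (x y : CuCompletion S) :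
    (cuIdealPreorder K).rel x y ↔ map p hp.mono x ≤ map p hp.mono y := by
  constructor
  · rintro ⟨z, hz, h⟩
    refine le_iff.2 fun b hb => ?_
    obtain ⟨a, ha, hba⟩ := (mem_map _).1 hb
    obtain ⟨c, d, hc, hd, hacd⟩ := mem_add.1 (le_iff.1 h a ha)
    refine (mem_map _).2 ⟨c, hc, IsWSemigroup.trans _ _ _ hba ?_⟩
    have := hp.mono _ _ hacd
    rwa [map_add, h0 d ((hK z).1 hz d hd), add_zero] at this
  · intro h
    obtain ⟨s, rfl⟩ := MonoidPreorder.proj_surjective _ x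
    obtain ⟨t, rfl⟩ := MonoidPreorder.proj_surjective _ y
    -- The comparison is applied at `n + 1` because `≤_J` only controls elements strictly `≺` the
    -- left side, here `s n ≺ s (n + 1)`.
    have h' : ∀ n, ∃ m, ∃ y ∈ J, s.1 n ≺ t.1 m + y := fun n => by
      obtain ⟨m, hm⟩ := h (n + 1)
      obtain ⟨y, hy, h⟩ := hpJ _ _ hm (s.1 n) (s.2 n)
      exact ⟨m, y, hy, h⟩
    choose m y hy hsy using h'
    -- The error terms `y k` vary with `k`; the supremum `z` of their partial sums dominates all of
    -- them and still lies in `K`.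
    have hmono : Monotone fun n => ∑ k ∈ Finset.range n, of (y k) :=
      monotone_nat_of_le_succ fun n => by
        rw [Finset.sum_range_succ]
        exact le_add_of_nonneg_right (IsCuSemigroup.zero_le _)
    have hof : ∀ n, of (y n) ∈ K := fun n => (hK _).2 fun a ha =>
      hJ.mem_of_prec _ _ (mem_of.1 ha) (hy n)
    obtain ⟨z, hz⟩ := exists_mem_iff_exists _ hmono
    refine ⟨z, (hK z).2 fun a ha => ?_, le_iff.2 fun a ha => ?_⟩
    · obtain ⟨n, hn⟩ := (hz a).1 ha
      exact (hK _).1 (K.sum_mem fun k _ => hof k) a hn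
    · obtain ⟨n, hn⟩ := mem_proj.1 ha
      obtain ⟨b, c, h1, h2, h3⟩ := IsWSemigroup.w4 _ _ _ (IsWSemigroup.trans _ _ _ hn (hsy n))
      refine mem_add.2 ⟨b, c, mem_proj.2 ⟨_, h2⟩, (hz c).2 ⟨n + 1, ?_⟩, h1⟩
      refine le_iff.1 ?_ c (mem_of.2 h3)
      rw [Finset.sum_range_succ]
      exact le_add_of_nonneg_left (IsCuSemigroup.zero_le _)

end Quotient

end CuCompletion

end Completion

attribute [local instance] CStarAlgebra.spectralOrder CStarAlgebra.spectralOrderedRing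

/-! ### Cuntz comparison of elements of a C*-algebra -/

section Generic

variable {B : Type*} [NonUnitalCStarAlgebra B]

/-- Cuntz subequivalence of elements of a C*-algebra. -/
def ConjLE (a b : B) : Prop := ∀ ε : ℝ, 0 < ε → ∃ x : B, ‖a - x * b * star x‖ < ε

theorem norm_conj_le (x d : B) : ‖x * d * star x‖ ≤ ‖x‖ ^ 2 * ‖d‖ := by
  refine (norm_mul_le _ _).trans ?_
  rw [norm_star]
  have := norm_mul_le x d
  nlinarith [norm_nonneg x]

theorem conj_sub (x b c : B) : x * (b - c) * star x = x * b * star x - x * c * star x := by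
  rw [mul_sub, sub_mul]

theorem exists_pos_sq_mul_lt (r : ℝ) {ε : ℝ} (hε : 0 < ε) : ∃ δ : ℝ, 0 < δ ∧ r ^ 2 * δ < ε := by
  refine ⟨ε / (r ^ 2 + 1), by positivity, ?_⟩
  rw [← mul_div_assoc, div_lt_iff₀ (by positivity)]
  nlinarith

theorem ConjLE.trans {a b c : B} (h : ConjLE a b) (h' : ConjLE b c) : ConjLE a c := by
  intro ε hε
  obtain ⟨x, hx⟩ := h (ε / 2) (half_pos hε)
  obtain ⟨δ, hδ, hxδ⟩ := exists_pos_sq_mul_lt ‖x‖ (half_pos hε)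
  obtain ⟨y, hy⟩ := h' δ hδ
  refine ⟨x * y, ?_⟩
  have e : a - x * y * c * star (x * y) =
      (a - x * b * star x) + x * (b - y * c * star y) * star x := by
    rw [conj_sub, star_mul]; noncomm_ring
  rw [e]
  have h1 := norm_add_le (a - x * b * star x) (x * (b - y * c * star y) * star x)
  have h2 := norm_conj_le x (b - y * c * star y)
  have h3 : ‖x‖ ^ 2 * ‖b - y * c * star y‖ ≤ ‖x‖ ^ 2 * δ := by gcongr
  linarith

theorem conjLE_conj (x b : B) : ConjLE (x * b * star x) b := fun ε hε => ⟨x, by simpa using hε⟩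

/-- `≾` is closed in the first variable. -/
theorem ConjLE.of_approx {a b : B} (h : ∀ ε : ℝ, 0 < ε → ∃ a', ConjLE a' b ∧ ‖a - a'‖ < ε) :
    ConjLE a b := by
  intro ε hε
  obtain ⟨a', h', ha'⟩ := h (ε / 2) (half_pos hε)
  obtain ⟨x, hx⟩ := h' (ε / 2) (half_pos hε)
  refine ⟨x, ?_⟩
  have := norm_sub_le_norm_sub_add_norm_sub a a' (x * b * star x)
  linarith

/-- Functional calculus turns a norm estimate for elements generated by `a` into a pointwise
estimate on `t ≥ 0`. -/
theorem norm_cfc_sub_conj_le {a : B} (ha : 0 ≤ a) {f h k : ℝ → ℝ} (hf : Continuous f)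
    (hh : Continuous h) (hk : Continuous k) (hf0 : f 0 = 0) (hh0 : h 0 = 0) (hk0 : k 0 = 0) {c : ℝ}
    (hc : ∀ t, 0 ≤ t → |h t - k t * f t * k t| ≤ c) :
    ‖cfcₙ h a - cfcₙ k a * cfcₙ f a * star (cfcₙ k a)‖ ≤ c := by
  have hsa : IsSelfAdjoint a := .of_nonneg ha
  have hstar : star (cfcₙ k a) = cfcₙ k a := cfcₙ_predicate k a
  rw [hstar, ← cfcₙ_mul k f a hk.continuousOn hk0 hf.continuousOn hf0,
    ← cfcₙ_mul (fun t => k t * f t) k a (by fun_prop) (by simp [hk0]) hk.continuousOn hk0,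
    ← cfcₙ_sub h (fun t => k t * f t * k t) a hh.continuousOn hh0 (by fun_prop) (by simp [hk0])]
  exact norm_cfcₙ_le fun t ht => hc t (quasispectrum_nonneg_of_nonneg a ha t ht)

theorem conjLE_mul_self {a : B} (ha : 0 ≤ a) : ConjLE a (a * a) := by
  intro ε hε
  have hsa : IsSelfAdjoint a := .of_nonneg ha
  have hid : cfcₙ (fun t : ℝ => t) a = a := cfcₙ_id' ℝ a
  have hsq : cfcₙ (fun t : ℝ => t * t) a = a * a := by
    rw [cfcₙ_mul (fun t : ℝ => t) (fun t : ℝ => t) a continuousOn_id rfl continuousOn_id rfl, hid]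
  have hpos : ∀ t : ℝ, 0 < t ^ 2 + ε ^ 2 := fun t => by positivity
  -- With `k(t)² = t / (t² + ε²)` the error is `t ε² / (t² + ε²)`, at most `ε / 2` because `2 t ε ≤
  -- t² + ε²`.
  have := norm_cfc_sub_conj_le ha (f := fun t => t * t) (h := fun t => t)
    (k := fun t => Real.sqrt (t / (t ^ 2 + ε ^ 2))) (c := ε / 2) (by fun_prop) continuous_id
    (Real.continuous_sqrt.comp (continuous_id.div (by fun_prop) fun t => (hpos t).ne'))
    (by simp) rfl (by simp) fun t ht => ?_
  · rw [hid, hsq] at this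
    exact ⟨_, this.trans_lt (half_lt_self hε)⟩
  · have h1 : Real.sqrt (t / (t ^ 2 + ε ^ 2)) * (t * t) * Real.sqrt (t / (t ^ 2 + ε ^ 2)) =
        t / (t ^ 2 + ε ^ 2) * (t * t) := by
      rw [mul_right_comm, Real.mul_self_sqrt (by positivity)]
    have h2 : t - t / (t ^ 2 + ε ^ 2) * (t * t) = t * ε ^ 2 / (t ^ 2 + ε ^ 2) := by
      have := (hpos t).ne'
      field_simp
      ring
    rw [h1, h2, abs_of_nonneg (by positivity), div_le_iff₀ (hpos t)]
    nlinarith [sq_nonneg (t - ε)]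

/-- `v* v ≾ (v* v)² = v* (v v*) v ≾ v v*`. -/
theorem conjLE_star_mul_self (v : B) : ConjLE (star v * v) (v * star v) := by
  refine (conjLE_mul_self (star_mul_self_nonneg v)).trans ?_
  have : star v * v * (star v * v) = star v * (v * star v) * star (star v) := by
    rw [star_star]; noncomm_ring
  rw [this]
  exact conjLE_conj _ _

/-- Write `a = s* s` and `b = r* r`, and let `e` be a function of `b` with `r e` close to `r`.
Domination forces `s e` close to `s`, so `a` is close to `(s e)* (s e)`; this is `≾ b` because `e`
is divisible by `b`. -/
theorem ConjLE.of_le {a b : B} (ha : 0 ≤ a) (hab : a ≤ b) : ConjLE a b := by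
  obtain ⟨s, rfl⟩ := nonneg_iff.1 ha
  have hb : 0 ≤ b := ha.trans hab
  obtain ⟨r, rfl⟩ := nonneg_iff.1 hb
  set b := star r * r with hbdef
  have hsa : IsSelfAdjoint b := .of_nonneg hb
  refine .of_approx fun ε hε => ?_
  have hη : ∃ η : ℝ, 0 < η ∧ η * (2 * ‖s‖ + η) < ε := by
    refine ⟨min 1 (ε / (2 * ‖s‖ + 2)), by positivity, ?_⟩
    have h1 := min_le_left 1 (ε / (2 * ‖s‖ + 2))
    have h2 := min_le_right 1 (ε / (2 * ‖s‖ + 2))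
    rw [le_div_iff₀ (by positivity)] at h2
    have h3 : 0 < min 1 (ε / (2 * ‖s‖ + 2)) := by positivity
    nlinarith
  obtain ⟨η, hη, hηε⟩ := hη
  -- Here `e = b k(b)`, and the scale `η ^ 4` gives `t (1 - t k(t)) ≤ η²` for `t ≥ 0`, hence `‖r - r
  -- e‖ ≤ η`.
  obtain ⟨k, hk, hk0, hkt⟩ : ∃ k : ℝ → ℝ, Continuous k ∧ k 0 = 0 ∧
      ∀ t, 1 - t * k t = η ^ 4 / (t ^ 2 + η ^ 4) := by
    have hpos : ∀ t : ℝ, t ^ 2 + η ^ 4 ≠ 0 := fun t => by positivity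
    refine ⟨fun t => t / (t ^ 2 + η ^ 4), continuous_id.div (by fun_prop) hpos, by simp,
      fun t => ?_⟩
    have := hpos t
    field_simp
    ring
  obtain ⟨e, he⟩ : ∃ e, e = cfcₙ (fun t => t * k t) b := ⟨_, rfl⟩
  have hr : ‖r - r * e‖ ≤ η := by
    have : ‖r - r * e‖ ^ 2 ≤ η ^ 2 := by
      rw [he, hbdef]
      refine ClosedIdeal.norm_sub_mul_cfc_sq_le (by fun_prop) (by simp) fun t ht => ?_
      have hpos : 0 < t ^ 2 + η ^ 4 := by positivity
      rw [hkt, abs_of_nonneg (by positivity)]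
      have h1 : η ^ 4 / (t ^ 2 + η ^ 4) ≤ 1 := by
        rw [div_le_one hpos]
        nlinarith [sq_nonneg t]
      refine (mul_le_of_le_one_right (by positivity) h1).trans ?_
      rw [← mul_div_assoc, div_le_iff₀ hpos]
      nlinarith [mul_nonneg (sq_nonneg η) (sq_nonneg (t - η ^ 2)), mul_nonneg (sq_nonneg η)
        (mul_nonneg ht (sq_nonneg η))]
    exact le_of_sq_le_sq this hη.le
  have hes : star e = e := by
    rw [he]
    exact (cfcₙ_predicate (fun t => t * k t) b : IsSelfAdjoint _)
  -- Compressing `a ≤ b` by `1 - e` gives `(s - s e)* (s - s e) ≤ (r - r e)* (r - r e)`; the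
  -- difference is exhibited as a square using `b - a = q* q`.
  have hs : ‖s - s * e‖ ≤ η := by
    refine le_trans ?_ hr
    refine le_of_sq_le_sq ?_ (norm_nonneg _)
    rw [sq, sq, ← CStarRing.norm_star_mul_self, ← CStarRing.norm_star_mul_self]
    refine CStarAlgebra.norm_le_norm_of_nonneg_of_le (star_mul_self_nonneg _) ?_
    obtain ⟨q, hq⟩ := nonneg_iff.1 (sub_nonneg.2 hab)
    rw [← sub_nonneg]
    refine nonneg_iff.2 ⟨q - q * e, ?_⟩
    have exp : ∀ w : B, star (w - w * e) * (w - w * e) =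
        star w * w - star w * w * e - e * (star w * w) + e * (star w * w) * e := fun w => by
      rw [star_sub, star_mul, hes]; noncomm_ring
    rw [exp, exp, exp, ← hq, hbdef]
    noncomm_ring
  refine ⟨star (s * e) * (s * e), ?_, ?_⟩
  -- The chain is `(s e)* (s e) ≾ s e² s* ≾ b² = r* (r r*) r ≾ r r* ≾ r* r = b`.
  · refine (conjLE_star_mul_self _).trans ?_
    have hid : cfcₙ (fun t : ℝ => t) b = b := cfcₙ_id' ℝ b
    have e1 : e = b * cfcₙ k b := by
      rw [he, cfcₙ_mul (fun t : ℝ => t) k b continuousOn_id rfl hk.continuousOn hk0, hid]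
    have e2 : e = cfcₙ k b * b := by
      rw [← hes, e1, star_mul, hsa.star_eq, (cfcₙ_predicate k b : IsSelfAdjoint _).star_eq]
    have e3 : s * e * star (s * e) = s * cfcₙ k b * (b * b) * star (s * cfcₙ k b) := by
      rw [star_mul, hes, star_mul, (cfcₙ_predicate k b : IsSelfAdjoint _).star_eq]
      nth_rewrite 1 [e2]
      rw [e1]
      noncomm_ring
    rw [e3]
    refine (conjLE_conj _ _).trans ?_
    have e4 : b * b = star r * (r * star r) * star (star r) := by
      rw [hbdef, star_star]; noncomm_ring
    rw [e4]
    refine (conjLE_conj _ _).trans ?_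
    simpa only [star_star] using conjLE_star_mul_self (star r)
  · have e5 : star s * s - star (s * e) * (s * e) =
        star s * (s - s * e) + star (s - s * e) * (s * e) := by
      rw [star_sub]; noncomm_ring
    have h1 : ‖s * e‖ ≤ ‖s‖ + η := by
      have := norm_sub_norm_le (s * e) s
      rw [norm_sub_rev] at this
      linarith
    calc ‖star s * s - star (s * e) * (s * e)‖
        ≤ ‖star s * (s - s * e)‖ + ‖star (s - s * e) * (s * e)‖ := e5 ▸ norm_add_le _ _
      _ ≤ ‖s‖ * η + η * (‖s‖ + η) := by
          gcongr
          · refine (norm_mul_le _ _).trans ?_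
            rw [norm_star]
            gcongr
          · refine (norm_mul_le _ _).trans ?_
            rw [norm_star]
            gcongr
      _ < ε := by linarith

theorem cutdown_fun_zero {δ : ℝ} (hδ : 0 ≤ δ) : max (0 - δ) 0 = 0 := by simpa using hδ

theorem cutdown_nonneg (δ : ℝ) (b : B) : 0 ≤ cutdown δ b :=
  cfcₙ_nonneg fun _ _ => le_max_right _ _

theorem cutdown_cutdown {δ δ' : ℝ} (hδ : 0 ≤ δ) (hδ' : 0 ≤ δ') {b : B} (hb : 0 ≤ b) :
    cutdown δ (cutdown δ' b) = cutdown (δ + δ') b := by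
  have hsa : IsSelfAdjoint b := .of_nonneg hb
  rw [cutdown, cutdown, ← cfcₙ_comp' (fun t : ℝ => max (t - δ) 0) (fun t : ℝ => max (t - δ') 0) b
    (by fun_prop) (cutdown_fun_zero hδ) (by fun_prop) (cutdown_fun_zero hδ')]
  refine cfcₙ_congr fun t _ => ?_
  rcases le_total (t - δ') 0 with h | h
  · rw [max_eq_right h, max_eq_right (by linarith), max_eq_right (by linarith)]
  · rw [max_eq_left h]
    congr 1
    ring

theorem norm_sub_cutdown_le {δ : ℝ} (hδ : 0 ≤ δ) {b : B} (hb : 0 ≤ b) :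
    ‖b - cutdown δ b‖ ≤ δ := by
  have hsa : IsSelfAdjoint b := .of_nonneg hb
  nth_rewrite 1 [← cfcₙ_id' ℝ b]
  rw [cutdown, ← cfcₙ_sub (fun t : ℝ => t) (fun t : ℝ => max (t - δ) 0) b continuousOn_id rfl
    (by fun_prop) (cutdown_fun_zero hδ)]
  refine norm_cfcₙ_le fun t ht => ?_
  have ht0 := quasispectrum_nonneg_of_nonneg b hb t ht
  rw [Real.norm_eq_abs, abs_le]
  rcases le_total (t - δ) 0 with h | h
  · rw [max_eq_right h]
    constructor <;> linarith
  · rw [max_eq_left h]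
    constructor <;> linarith

theorem cutdown_conjLE {δ : ℝ} (hδ : 0 ≤ δ) {b : B} (hb : 0 ≤ b) : ConjLE (cutdown δ b) b := by
  have hsa : IsSelfAdjoint b := .of_nonneg hb
  refine .of_le (cutdown_nonneg δ b) ?_
  nth_rewrite 2 [← cfcₙ_id' ℝ b]
  refine cfcₙ_mono (fun t ht => ?_) (by fun_prop) (by fun_prop) (cutdown_fun_zero hδ) rfl
  have ht0 := quasispectrum_nonneg_of_nonneg b hb t ht
  exact max_le (by linarith) ht0

theorem map_cutdown {C : Type*} [NonUnitalCStarAlgebra C] (φ : B →⋆ₙₐ[ℂ] C) {δ : ℝ} (hδ : 0 ≤ δ)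
    {b : B} (hb : IsSelfAdjoint b) : φ (cutdown δ b) = cutdown δ (φ b) := by
  have hb' : IsSelfAdjoint (φ b) := hb.map φ
  exact φ.map_cfcₙ (fun t : ℝ => max (t - δ) 0) b (by fun_prop) (cutdown_fun_zero hδ)
    (by fun_prop) hb hb'

/-- If `a + d` is within `ε` of `c`, then `(a - ε)₊ ≾ c`. -/
theorem cutdown_conjLE_of_norm_le {a c d : B} (ha : 0 ≤ a) (hc : IsSelfAdjoint c) (hd : 0 ≤ d) {ε : ℝ}
    (hε : 0 ≤ ε) (h : ‖a + d - c‖ ≤ ε) : ConjLE (cutdown ε a) c := by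
  have hsa : IsSelfAdjoint a := .of_nonneg ha
  -- `F` is the square root of `(a - ε)₊`, so that `F a F - ε F² = ((a - ε)₊)²`.
  obtain ⟨f, hf⟩ : ∃ f : ℝ → ℝ, f = fun t => Real.sqrt (max (t - ε) 0) := ⟨_, rfl⟩
  have hfc : Continuous f := by rw [hf]; fun_prop
  have hf0 : f 0 = 0 := by simp [hf, hε]
  obtain ⟨F, hF⟩ : ∃ F, F = cfcₙ f a := ⟨_, rfl⟩
  have hFs : star F = F := by rw [hF]; exact cfcₙ_predicate f a
  have hid : cfcₙ (fun t : ℝ => t) a = a := cfcₙ_id' ℝ a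
  have e1 : cutdown ε a * cutdown ε a = F * a * F - ε • (F * F) := by
    have m1 : cfcₙ (fun t : ℝ => f t * t * f t) a = F * a * F := by
      rw [cfcₙ_mul (fun t : ℝ => f t * t) f a (by fun_prop) (by simp) hfc.continuousOn hf0,
        cfcₙ_mul f (fun t : ℝ => t) a hfc.continuousOn hf0 continuousOn_id rfl, hid, hF]
    have m2 : cfcₙ (fun t : ℝ => ε • (f t * f t)) a = ε • (F * F) := by
      rw [cfcₙ_smul ε (fun t : ℝ => f t * f t) a (by fun_prop) (by simp [hf0]),
        cfcₙ_mul f f a hfc.continuousOn hf0 hfc.continuousOn hf0, hF]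
    rw [cutdown, ← cfcₙ_mul (fun t : ℝ => max (t - ε) 0) (fun t : ℝ => max (t - ε) 0) a
      (by fun_prop) (cutdown_fun_zero hε) (by fun_prop) (cutdown_fun_zero hε), ← m1, ← m2,
      ← cfcₙ_sub (fun t : ℝ => f t * t * f t) (fun t : ℝ => ε • (f t * f t)) a
        (by fun_prop) (by simp) (by fun_prop) (by simp [hf0])]
    refine cfcₙ_congr fun t _ => ?_
    have hft : f t * f t = max (t - ε) 0 := by
      rw [hf]
      exact Real.mul_self_sqrt (le_max_right _ _)
    have : f t * t * f t - ε • (f t * f t) = (f t * f t) * (t - ε) := by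
      rw [smul_eq_mul]; ring
    change max (t - ε) 0 * max (t - ε) 0 = f t * t * f t - ε • (f t * f t)
    rw [this, hft]
    rcases le_total (t - ε) 0 with h | h
    · rw [max_eq_right h]; ring
    · rw [max_eq_left h]
  -- Since `F (a + d - c) F ≤ ε F²`, one has `((a - ε)₊)² ≤ F c F - F d F ≤ F c F`. Positivity of
  -- `c` itself is not needed.
  refine (conjLE_mul_self (cutdown_nonneg ε a)).trans (ConjLE.trans (b := F * c * star F) ?_
    (conjLE_conj F c))
  refine .of_le ?_ ?_
  · have := star_mul_self_nonneg (cutdown ε a)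
    rwa [(IsSelfAdjoint.of_nonneg (cutdown_nonneg ε a)).star_eq] at this
  · have hdF : 0 ≤ star F * d * F := star_left_conjugate_nonneg hd F
    have hsa' : IsSelfAdjoint (a + d - c) :=
      (hsa.add (.of_nonneg hd)).sub hc
    have h1 : star F * (a + d - c) * F ≤ ‖a + d - c‖ • (star F * F) :=
      CStarAlgebra.star_left_conjugate_le_norm_smul hsa'
    have h2 : ‖a + d - c‖ • (star F * F) ≤ ε • (star F * F) :=
      smul_le_smul_of_nonneg_right h (star_mul_self_nonneg F)
    have h3 := h1.trans h2
    rw [hFs] at h3 hdF ⊢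
    rw [e1, sub_le_iff_le_add]
    have e : F * a * F = F * (a + d - c) * F + F * c * F - F * d * F := by noncomm_ring
    rw [e, sub_le_iff_le_add, add_comm (F * c * F)]
    exact (add_le_add_left h3 _).trans (le_add_of_nonneg_right hdF)

end Generic

/-! ### Cuntz comparison of matrices and Rørdam's lemma -/

section Matrices

variable {A : Type*} [NonUnitalCStarAlgebra A]
variable {l m n : Type*} [Fintype l] [Fintype m] [Fintype n]

theorem cuntzLE_conj (x : CStarMatrix m n A) (b : CStarMatrix n n A) :
    CuntzLE (x * b * x.conjTranspose) b := fun ε hε => ⟨x, by simpa using hε⟩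

theorem isSelfAdjoint_conj (x : CStarMatrix m n A) {b : CStarMatrix n n A} (hb : IsSelfAdjoint b) :
    IsSelfAdjoint (x * b * x.conjTranspose) := by
  have h : Matrix.conjTranspose (α := A) b = b := hb
  have e : Matrix.conjTranspose (α := A)
      (Matrix.of x * Matrix.of b * Matrix.conjTranspose (Matrix.of x)) =
      Matrix.of x * Matrix.of b * Matrix.conjTranspose (Matrix.of x) := by
    rw [Matrix.conjTranspose_mul, Matrix.conjTranspose_mul, Matrix.conjTranspose_conjTranspose,
      Matrix.mul_assoc]
    congr 2
  exact e

theorem continuous_conj (x : CStarMatrix m n A) :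
    Continuous fun d : CStarMatrix n n A => x * d * x.conjTranspose := by
  refine continuous_pi fun i => continuous_pi fun j => ?_
  simp only [CStarMatrix.mul_apply]
  refine continuous_finsetSum _ fun s _ => (continuous_finsetSum _ fun s' _ => ?_).mul
    continuous_const
  exact continuous_const.mul ((continuous_apply s).comp (continuous_apply s'))

theorem cuntzLE_of_forall_cutdown {a : CStarMatrix m m A} (ha : 0 ≤ a) {b : CStarMatrix n n A}
    (h : ∀ ε : ℝ, 0 < ε → CuntzLE (cutdown ε a) b) : CuntzLE a b := by
  intro ε hε
  obtain ⟨x, hx⟩ := h (ε / 2) (half_pos hε) (ε / 2) (half_pos hε)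
  refine ⟨x, ?_⟩
  have h1 := norm_sub_le_norm_sub_add_norm_sub a (cutdown (ε / 2) a) (x * b * x.conjTranspose)
  have h2 := norm_sub_cutdown_le (half_pos hε).le ha
  linarith

theorem cutdown_cuntzLE {δ : ℝ} (hδ : 0 ≤ δ) {b : CStarMatrix n n A} (hb : 0 ≤ b) :
    CuntzLE (cutdown δ b) b :=
  cutdown_conjLE hδ hb

theorem cutdown_cuntzLE_cutdown {δ δ' : ℝ} (hδ : 0 ≤ δ) (h : δ ≤ δ') {b : CStarMatrix n n A}
    (hb : 0 ≤ b) : CuntzLE (cutdown δ' b) (cutdown δ b) := by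
  have := cutdown_cuntzLE (sub_nonneg.2 h) (cutdown_nonneg δ b)
  rwa [cutdown_cutdown (sub_nonneg.2 h) hδ hb, sub_add_cancel] at this

/-- Rørdam's lemma: if `b ≾ c`, then every `(b - ε)₊` is below some `(c - δ)₊`. -/
theorem CuntzLE.exists_cutdown {b : CStarMatrix m m A} {c : CStarMatrix n n A} (h : CuntzLE b c)
    (hb : 0 ≤ b) (hc : 0 ≤ c) {ε : ℝ} (hε : 0 < ε) :
    ∃ δ : ℝ, 0 < δ ∧ CuntzLE (cutdown ε b) (cutdown δ c) := by
  obtain ⟨x, hx⟩ := h (ε / 2) (half_pos hε)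
  -- Cutting `c` down slightly moves `x c x*` by less than `ε / 2`, so `b` stays within `ε` of the
  -- new conjugate.
  obtain ⟨δ, hδ, hd⟩ := Metric.continuous_iff.1 (continuous_conj x) c (ε / 2) (half_pos hε)
  have hδ2 := norm_sub_cutdown_le (half_pos hδ).le hc
  have h1 := hd (cutdown (δ / 2) c) (by rw [dist_eq_norm, norm_sub_rev]; linarith)
  rw [dist_eq_norm, norm_sub_rev] at h1
  refine ⟨δ / 2, half_pos hδ, CuntzLE.trans ?_ (cuntzLE_conj x (cutdown (δ / 2) c))⟩
  refine cutdown_conjLE_of_norm_le hb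
    (isSelfAdjoint_conj x (.of_nonneg (cutdown_nonneg _ _))) le_rfl hε.le ?_
  rw [add_zero]
  have h2 := norm_sub_le_norm_sub_add_norm_sub b (x * c * x.conjTranspose)
    (x * cutdown (δ / 2) c * x.conjTranspose)
  linarith

/-- This makes `≺` independent of the representative on the right: a gap below `b` is converted into
a gap below `c`. -/
theorem CuntzLE.exists_cutdown_trans {a : CStarMatrix l l A} {b : CStarMatrix m m A}
    {c : CStarMatrix n n A} (hb : 0 ≤ b) (hc : 0 ≤ c) {δ : ℝ} (hδ : 0 < δ)
    (h : CuntzLE a (cutdown δ b)) (h' : CuntzLE b c) :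
    ∃ δ' : ℝ, 0 < δ' ∧ CuntzLE a (cutdown δ' c) := by
  obtain ⟨δ', hδ', h1⟩ := h'.exists_cutdown hb hc hδ
  exact ⟨δ', hδ', h.trans h1⟩

theorem fromBlocks_diag_mul (a c : Matrix m m A) (b d : Matrix n n A) :
    Matrix.fromBlocks a 0 0 b * Matrix.fromBlocks c 0 0 d =
      Matrix.fromBlocks (a * c) 0 0 (b * d) := by
  rw [Matrix.fromBlocks_multiply]
  simp only [Matrix.mul_zero, Matrix.zero_mul, add_zero, zero_add]

theorem fromCols_conj (x : Matrix m n A) (u : Matrix m m A) (b : Matrix n n A) (d : Matrix m m A) :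
    Matrix.fromCols x u * Matrix.fromBlocks b 0 0 d * (Matrix.fromCols x u).conjTranspose =
      x * b * x.conjTranspose + u * d * u.conjTranspose := by
  ext i j
  simp only [Matrix.mul_apply, Matrix.add_apply, Fintype.sum_sum_type, Matrix.conjTranspose_apply,
    Matrix.fromCols_apply_inl, Matrix.fromCols_apply_inr, Matrix.fromBlocks_apply₁₁,
    Matrix.fromBlocks_apply₁₂, Matrix.fromBlocks_apply₂₁, Matrix.fromBlocks_apply₂₂,
    Matrix.zero_apply, mul_zero, Finset.sum_const_zero, add_zero, zero_add]

/-- The block sum as a `*`-homomorphism. -/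
def dsumHom : CStarMatrix m m A × CStarMatrix n n A →⋆ₙₐ[ℂ] CStarMatrix (m ⊕ n) (m ⊕ n) A where
  toFun x := dsum x.1 x.2
  map_smul' c x := by
    ext i j
    rcases i with i | i <;> rcases j with j | j
    · rfl
    · exact (smul_zero c).symm
    · exact (smul_zero c).symm
    · rfl
  map_zero' := Matrix.fromBlocks_zero
  map_add' x y := by
    ext i j
    rcases i with i | i <;> rcases j with j | j
    · rfl
    · exact (add_zero 0).symm
    · exact (add_zero 0).symm
    · rfl
  map_mul' x y := by
    have := fromBlocks_diag_mul (A := A) x.1 y.1 x.2 y.2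
    exact this.symm
  map_star' x := by
    ext i j
    rcases i with i | i <;> rcases j with j | j
    · rfl
    · exact (star_zero A).symm
    · exact (star_zero A).symm
    · rfl

/-- Functional calculus commutes with `*`-homomorphisms, here with the block sum and with both
coordinate projections of the product algebra. -/
theorem cutdown_dsum {δ : ℝ} (hδ : 0 ≤ δ) {a : CStarMatrix m m A} {b : CStarMatrix n n A}
    (ha : 0 ≤ a) (hb : 0 ≤ b) :
    cutdown δ (dsum a b) = dsum (cutdown δ a) (cutdown δ b) := by
  have hsa : IsSelfAdjoint a := .of_nonneg ha
  have hsb : IsSelfAdjoint b := .of_nonneg hb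
  have hab : IsSelfAdjoint (a, b) := Prod.ext hsa hsb
  have h1 := map_cutdown (dsumHom (A := A) (m := m) (n := n)) hδ hab
  have h2 : cutdown δ (a, b) = (cutdown δ a, cutdown δ b) :=
    Prod.ext (map_cutdown (NonUnitalStarAlgHom.fst ℂ _ _) hδ hab)
      (map_cutdown (NonUnitalStarAlgHom.snd ℂ _ _) hδ hab)
  rw [h2] at h1
  exact h1.symm

/-- The matrix `x b x* + d` is below the block sum of `b` and `d`. -/
theorem cuntzLE_conj_add (x : CStarMatrix m n A) (b : CStarMatrix n n A) {d : CStarMatrix m m A}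
    (hd : 0 ≤ d) : CuntzLE (x * b * x.conjTranspose + d) (dsum b d) := by
  intro ε hε
  obtain ⟨u, hu⟩ := CuntzLE.refl hd ε hε
  -- Conjugating `b ⊕ d` by the row `(x u)` gives `x b x* + u d u*`, and `u d u*` is close to `d`.
  refine ⟨CStarMatrix.ofMatrix (Matrix.fromCols (x : Matrix m n A) (u : Matrix m m A)), ?_⟩
  convert hu using 2
  have e : (CStarMatrix.ofMatrix (Matrix.fromCols (x : Matrix m n A) (u : Matrix m m A)) :
      CStarMatrix m (n ⊕ m) A) * dsum b d *
      (CStarMatrix.ofMatrix (Matrix.fromCols (x : Matrix m n A) (u : Matrix m m A)) :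
      CStarMatrix m (n ⊕ m) A).conjTranspose = x * b * x.conjTranspose + u * d * u.conjTranspose :=
    fromCols_conj (A := A) x u b d
  rw [e]
  abel

end Matrices

/-! ### `W(A)` is a W-semigroup, functorially -/

section CuntzSemigroup

variable {A : Type*} [NonUnitalCStarAlgebra A]

namespace PosMat

/-- The positive matrix `(a - δ)₊`. -/
noncomputable def cutdown (δ : ℝ) (a : PosMat A) : PosMat A :=
  ⟨a.size, DynCuntz.cutdown δ a.mat, cutdown_nonneg δ a.mat⟩

theorem add_cuntzLE_dsum (a b : PosMat A) : CuntzLE (a + b).mat (dsum a.mat b.mat) :=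
  CuntzLE.permute_left _ (dsum_nonneg a.nonneg b.nonneg)

theorem dsum_cuntzLE_add (a b : PosMat A) : CuntzLE (dsum a.mat b.mat) (a + b).mat :=
  CuntzLE.permute_right _ (dsum_nonneg a.nonneg b.nonneg)

end PosMat

namespace W

theorem mk_prec_mk {a b : PosMat A} :
    mk a ≺ mk b ↔ ∃ δ : ℝ, 0 < δ ∧ CuntzLE a.mat (cutdown δ b.mat) := by
  constructor
  · rintro ⟨a', b', ha, hb, δ, hδ, h⟩
    exact ((mk_eq_mk.1 ha).2.trans h).exists_cutdown_trans b'.nonneg b.nonneg hδ (mk_eq_mk.1 hb).1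
  · rintro ⟨δ, hδ, h⟩
    exact ⟨a, b, rfl, rfl, δ, hδ, h⟩

theorem mk_cutdown_prec {δ : ℝ} (hδ : 0 < δ) (a : PosMat A) : mk (a.cutdown δ) ≺ mk a :=
  mk_prec_mk.2 ⟨δ, hδ, .refl (cutdown_nonneg _ _)⟩

theorem sub_of_prec {a b : PosMat A} (h : mk a ≺ mk b) : a.Sub b := by
  obtain ⟨δ, hδ, h⟩ := mk_prec_mk.1 h
  exact h.trans (cutdown_cuntzLE hδ.le b.nonneg)

theorem prec_of_prec_of_sub {x : W A} {a b : PosMat A} (h : x ≺ mk a) (h' : a.Sub b) :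
    x ≺ mk b := by
  obtain ⟨c, rfl⟩ := mk_surjective x
  obtain ⟨δ, hδ, h⟩ := mk_prec_mk.1 h
  exact mk_prec_mk.2 (h.exists_cutdown_trans a.nonneg b.nonneg hδ h')

theorem sub_of_forall_prec {a b : PosMat A} (h : ∀ x, x ≺ mk a → x ≺ mk b) : a.Sub b :=
  cuntzLE_of_forall_cutdown a.nonneg fun _ hε => sub_of_prec (h _ (mk_cutdown_prec hε a))

/-- `(a - δ)₊` is the cutdown of `(a - ε)₊` by `δ - ε`, so the classes of the cutdowns of `a` are
cofinal below the class of `a`. -/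
theorem exists_prec_cutdown {a : PosMat A} {x : W A} (h : x ≺ mk a) :
    ∃ δ : ℝ, 0 < δ ∧ ∀ ε, 0 < ε → ε < δ → x ≺ mk (a.cutdown ε) := by
  obtain ⟨c, rfl⟩ := mk_surjective x
  obtain ⟨δ, hδ, h⟩ := mk_prec_mk.1 h
  refine ⟨δ, hδ, fun ε hε hεδ => mk_prec_mk.2 ⟨δ - ε, sub_pos.2 hεδ, ?_⟩⟩
  change CuntzLE _ (cutdown (δ - ε) (cutdown ε a.mat))
  rwa [cutdown_cutdown (sub_pos.2 hεδ).le hε.le a.nonneg, sub_add_cancel]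

instance isWSemigroup : IsWSemigroup (W A) where
  trans x y z h h' := by
    obtain ⟨a, rfl⟩ := mk_surjective x
    obtain ⟨b, rfl⟩ := mk_surjective y
    obtain ⟨c, rfl⟩ := mk_surjective z
    obtain ⟨δ, hδ, h'⟩ := mk_prec_mk.1 h'
    exact mk_prec_mk.2 ⟨δ, hδ, (sub_of_prec h).trans h'⟩
  zero_prec x := by
    obtain ⟨a, rfl⟩ := mk_surjective x
    -- The zero class is represented by the matrix of size `0`, over which every norm vanishes.
    refine mk_prec_mk.2 ⟨1, one_pos, fun ε hε => ⟨0, ?_⟩⟩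
    have : ∀ y : CStarMatrix (Fin 0) (Fin 0) A, ‖y‖ < ε := fun y => by
      have : y = 0 := CStarMatrix.ext fun i => i.elim0
      rwa [this, norm_zero]
    exact this _
  w1 x := by
    obtain ⟨a, rfl⟩ := mk_surjective x
    refine ⟨fun k => mk (a.cutdown (1 / (k + 1))),
      fun k => mk_cutdown_prec Nat.one_div_pos_of_nat a, fun k => ?_, fun x hx => ?_⟩
    · have h1 : (1 : ℝ) / ((k + 1 : ℕ) + 1) < 1 / (k + 1) :=
        Nat.one_div_lt_one_div (Nat.lt_succ_self k)
      refine mk_prec_mk.2 ⟨_, sub_pos.2 h1, ?_⟩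
      change CuntzLE _ (cutdown _ (cutdown (1 / ((k + 1 : ℕ) + 1)) a.mat))
      rw [cutdown_cutdown (sub_pos.2 h1).le Nat.one_div_pos_of_nat.le a.nonneg, sub_add_cancel]
      exact .refl (cutdown_nonneg _ _)
    · obtain ⟨δ, hδ, h⟩ := exists_prec_cutdown hx
      obtain ⟨k, hk⟩ := exists_nat_one_div_lt hδ
      exact ⟨k, h _ Nat.one_div_pos_of_nat hk⟩
  w3 x x' y y' h h' := by
    obtain ⟨a, rfl⟩ := mk_surjective x
    obtain ⟨a', rfl⟩ := mk_surjective x'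
    obtain ⟨b, rfl⟩ := mk_surjective y
    obtain ⟨b', rfl⟩ := mk_surjective y'
    obtain ⟨δ, hδ, h⟩ := mk_prec_mk.1 h
    obtain ⟨δ', hδ', h'⟩ := mk_prec_mk.1 h'
    have hm : 0 < min δ δ' := lt_min hδ hδ'
    rw [← mk_add, ← mk_add, mk_prec_mk]
    refine CuntzLE.exists_cutdown_trans (dsum_nonneg a.nonneg b.nonneg) (a + b).nonneg hm ?_
      (PosMat.dsum_cuntzLE_add a b)
    rw [cutdown_dsum hm.le a.nonneg b.nonneg]
    exact (PosMat.add_cuntzLE_dsum a' b').trans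
      (.dsum (h.trans (cutdown_cuntzLE_cutdown hm.le (min_le_left _ _) a.nonneg))
        (h'.trans (cutdown_cuntzLE_cutdown hm.le (min_le_right _ _) b.nonneg)))
  w4 x y z h := by
    obtain ⟨a, rfl⟩ := mk_surjective x
    obtain ⟨b, rfl⟩ := mk_surjective y
    obtain ⟨c, rfl⟩ := mk_surjective z
    rw [← mk_add, mk_prec_mk] at h
    obtain ⟨δ, hδ, h⟩ := h
    obtain ⟨ε, hε, h⟩ := h.exists_cutdown_trans (b + c).nonneg (dsum_nonneg b.nonneg c.nonneg) hδ
      (PosMat.add_cuntzLE_dsum b c)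
    have hε2 := half_pos hε
    -- Half of the gap `ε` is spent on cutting down the summands; the other half remains as the gap
    -- below their sum.
    refine ⟨mk (b.cutdown (ε / 2)), mk (c.cutdown (ε / 2)), ?_, mk_cutdown_prec hε2 b,
      mk_cutdown_prec hε2 c⟩
    rw [← mk_add, mk_prec_mk]
    refine CuntzLE.exists_cutdown_trans (dsum_nonneg (b.cutdown (ε / 2)).nonneg
      (c.cutdown (ε / 2)).nonneg) (PosMat.nonneg _) hε2 ?_ (PosMat.dsum_cuntzLE_add _ _)
    change CuntzLE _ (cutdown (ε / 2) (dsum (cutdown (ε / 2) b.mat) (cutdown (ε / 2) c.mat)))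
    rwa [← cutdown_dsum hε2.le b.nonneg c.nonneg,
      cutdown_cutdown hε2.le hε2.le (dsum_nonneg b.nonneg c.nonneg), add_halves]

variable {B : Type*} [NonUnitalCStarAlgebra B]

theorem map_cutdown_mk (φ : A →⋆ₙₐ[ℂ] B) {δ : ℝ} (hδ : 0 ≤ δ) (a : PosMat A) :
    (a.cutdown δ).map φ = (a.map φ).cutdown δ := by
  have h := map_cutdown (CStarMatrix.mapₙₐ (n := Fin a.size) φ) hδ (.of_nonneg a.nonneg)
  change PosMat.mk _ _ _ = PosMat.mk _ _ _
  congr 1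

theorem map_isWMorphism (φ : A →⋆ₙₐ[ℂ] B) : IsWMorphism (W.map φ) where
  mono x y h := by
    obtain ⟨a, rfl⟩ := mk_surjective x
    obtain ⟨b, rfl⟩ := mk_surjective y
    obtain ⟨δ, hδ, h⟩ := mk_prec_mk.1 h
    refine mk_prec_mk.2 ⟨δ, hδ, ?_⟩
    have := PosMat.Sub.map φ (a := a) (b := b.cutdown δ) h
    rwa [map_cutdown_mk φ hδ.le] at this
  cont x y h := by
    obtain ⟨a, rfl⟩ := mk_surjective x
    obtain ⟨δ, hδ, h⟩ := exists_prec_cutdown (a := a.map φ) h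
    refine ⟨mk (a.cutdown (δ / 2)), mk_cutdown_prec (half_pos hδ) a, ?_⟩
    rw [map_mk, map_cutdown_mk φ (half_pos hδ).le]
    exact h _ (half_pos hδ) (half_lt_self hδ)

theorem act_isWMorphism {G : Type*} [Group G] (α : G →* (A ≃⋆ₐ[ℂ] A)) (g : G) :
    IsWMorphism (W.act α g) :=
  map_isWMorphism _

end W

end CuntzSemigroup

/-! ### Positive parts and cutdowns of self-adjoint elements -/

section Generic

variable {B C : Type*} [NonUnitalCStarAlgebra B] [NonUnitalCStarAlgebra C]

/-- The negative part of `b` is sent to that of `φ b`, which is zero, so injectivity kills it. -/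
theorem nonneg_of_map_nonneg (φ : B →⋆ₙₐ[ℂ] C) (hφ : Function.Injective φ) {b : B}
    (h : 0 ≤ φ b) : 0 ≤ b := by
  have hsa : IsSelfAdjoint b := hφ <| by
    rw [map_star]
    exact (IsSelfAdjoint.of_nonneg h).star_eq
  have hsa' : IsSelfAdjoint (φ b) := hsa.map φ
  rw [← CFC.negPart_eq_zero_iff b]
  refine hφ ?_
  rw [map_zero, CFC.negPart_def, φ.map_cfcₙ (fun t : ℝ => t⁻) b (by fun_prop) (by simp)
    (by fun_prop) hsa hsa', ← CFC.negPart_def, CFC.negPart_eq_zero_iff (φ b)]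
  exact h

theorem cutdown_eq_zero {b : B} (hb : IsSelfAdjoint b) {ε : ℝ} (h : ‖b‖ ≤ ε) :
    cutdown ε b = 0 := by
  refine (cfcₙ_congr fun t ht => ?_).trans (cfcₙ_const_zero ℝ b)
  have h1 := NonUnitalIsometricContinuousFunctionalCalculus.norm_quasispectrum_le b ht
  exact max_eq_right (by linarith [le_abs_self t, Real.norm_eq_abs t])

/-- Take `d = b⁻`: then `b + d = b⁺`, which differs from `(b - ε)₊` by at most `ε`. This feeds the
slack term `d` of `cutdown_conjLE_of_norm_le`. -/
theorem exists_norm_add_sub_cutdown_le {b : B} (hb : IsSelfAdjoint b) {ε : ℝ} (hε : 0 ≤ ε) :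
    ∃ d : B, 0 ≤ d ∧ ‖b + d - cutdown ε b‖ ≤ ε := by
  refine ⟨b⁻, CFC.negPart_nonneg b, ?_⟩
  have e : b + b⁻ = b⁺ := by
    nth_rewrite 1 [← CFC.posPart_sub_negPart b hb]
    abel
  rw [e, CFC.posPart_def, cutdown, ← cfcₙ_sub (fun t : ℝ => t⁺) (fun t : ℝ => max (t - ε) 0) b
    (by fun_prop) (by simp) (by fun_prop) (cutdown_fun_zero hε)]
  refine norm_cfcₙ_le fun t _ => ?_
  rw [Real.norm_eq_abs, abs_le, posPart_def]
  change -ε ≤ max t 0 - max (t - ε) 0 ∧ max t 0 - max (t - ε) 0 ≤ ε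
  rcases le_total t 0 with h | h <;> rcases le_total (t - ε) 0 with h' | h' <;>
    simp only [max_eq_left, max_eq_right, h, h'] <;> constructor <;> linarith

end Generic

/-! ### Cuntz comparison inside an ideal -/

section Injective

variable {A D : Type*} [NonUnitalCStarAlgebra A] [NonUnitalCStarAlgebra D] (φ : D →⋆ₙₐ[ℂ] A)
  (hφ : Function.Injective φ)
include hφ

theorem mapₙₐ_injective {n : Type*} [Fintype n] :
    Function.Injective (CStarMatrix.mapₙₐ (n := n) φ) := fun _ _ h =>
  CStarMatrix.ext fun i j => hφ (congrFun (congrFun h i) j)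

theorem PosMat.exists_map_of_injective {a : PosMat A} (ha : ∀ i j, ∃ d, φ d = a.mat i j) :
    ∃ b : PosMat D, b.map φ = a := by
  obtain ⟨n, a, ha0⟩ := a
  choose d hd using ha
  obtain ⟨d', rfl⟩ : ∃ d', CStarMatrix.mapₙₐ (n := Fin n) φ d' = a :=
    ⟨CStarMatrix.ofMatrix d, CStarMatrix.ext hd⟩
  exact ⟨⟨n, d', nonneg_of_map_nonneg _ (mapₙₐ_injective φ hφ) ha0⟩, rfl⟩

/-- The inclusion of a right ideal reflects Cuntz subequivalence. -/
theorem PosMat.sub_of_map_injective (hr : ∀ d a, ∃ d', φ d' = φ d * a) {a b : PosMat D}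
    (h : (a.map φ).Sub (b.map φ)) : a.Sub b := by
  intro ε hε
  -- A comparing matrix `x` has entries in the big algebra only. Multiplying it on the left by `u`,
  -- with `u a u*` close to `a`, brings the entries into the ideal.
  obtain ⟨u, hu⟩ := CuntzLE.refl a.nonneg (ε / 2) (half_pos hε)
  set φa := CStarMatrix.mapₙₐ (n := Fin a.size) φ with hφa
  set φb := CStarMatrix.mapₙₐ (n := Fin b.size) φ with hφb
  obtain ⟨δ, hδ, hd⟩ := Metric.continuous_iff.1 (continuous_conj (φa u)) 0 (ε / 2) (half_pos hε)
  obtain ⟨x, hx⟩ : ∃ x : CStarMatrix (Fin a.size) (Fin b.size) A,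
    ‖φa a.mat - x * φb b.mat * x.conjTranspose‖ < δ := h δ hδ
  have hd' := hd _ (by rwa [dist_zero_right])
  have hz : φa u * (0 : CStarMatrix (Fin a.size) (Fin a.size) A) * (φa u).conjTranspose = 0 := by
    rw [CStarMatrix.mul_zero, CStarMatrix.zero_mul]
  rw [hz, dist_zero_right] at hd'
  have hux : ∀ i j, ∃ d, φ d = (φa u * x : CStarMatrix (Fin a.size) (Fin b.size) A) i j := by
    intro i j
    choose d hd using fun s => hr (u i s) (x s j)
    refine ⟨∑ s, d s, ?_⟩
    rw [map_sum, CStarMatrix.mul_apply]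
    exact Finset.sum_congr rfl fun s _ => hd s
  choose y hy using hux
  obtain ⟨y, hy⟩ : ∃ y' : CStarMatrix (Fin a.size) (Fin b.size) D, Matrix.map y' φ = φa u * x :=
    ⟨CStarMatrix.ofMatrix y, CStarMatrix.ext hy⟩
  refine ⟨y, ?_⟩
  rw [← NonUnitalStarAlgHom.norm_map φa (mapₙₐ_injective φ hφ)]
  have e1 : φa (u * a.mat * u.conjTranspose) = φa u * φa a.mat * (φa u).conjTranspose := by
    ext i j
    exact matrix_map_conj φ u a.mat i j
  have e2 : φa (y * b.mat * y.conjTranspose) =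
      (φa u * x) * φb b.mat * (φa u * x).conjTranspose := by
    rw [← hy]
    ext i j
    exact matrix_map_conj φ y b.mat i j
  have e3 : φa u * (φa a.mat - x * φb b.mat * x.conjTranspose) * (φa u).conjTranspose =
      φa u * φa a.mat * (φa u).conjTranspose - φa u * (x * φb b.mat * x.conjTranspose) *
        (φa u).conjTranspose := matrix_conj_sub (A := A) _ _ _
  have e4 : φa u * (x * φb b.mat * x.conjTranspose) * (φa u).conjTranspose =
      (φa u * x) * φb b.mat * (φa u * x).conjTranspose := matrix_conj_conj (A := A) _ _ _
  have e : φa (a.mat - y * b.mat * y.conjTranspose) = φa (a.mat - u * a.mat * u.conjTranspose) +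
      φa u * (φa a.mat - x * φb b.mat * x.conjTranspose) * (φa u).conjTranspose := by
    rw [map_sub, map_sub, e1, e2, e3, e4, sub_add_sub_cancel]
  rw [e]
  have h1 := norm_map_le φ (a.mat - u * a.mat * u.conjTranspose)
  exact (norm_add_le _ _).trans_lt (by linarith)

end Injective

/-! ### `W(I)`, `W(A)` and `W(A / I)` -/

section Ideal

variable {A : Type*} [NonUnitalCStarAlgebra A] {I : ClosedIdeal A}

theorem matrix_mul_mem {l m n : Type*} [Fintype m] (x : Matrix l m A) (y : Matrix m n A)
    (hx : ∀ i j, x i j ∈ I) (i : l) (j : n) : (x * y) i j ∈ I := by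
  rw [Matrix.mul_apply]
  exact I.toSubmodule.sum_mem fun s _ => I.mul_mem_right' _ _ (hx i s)

theorem matrix_mul_mem' {l m n : Type*} [Fintype m] (x : Matrix l m A) (y : Matrix m n A)
    (hy : ∀ i j, y i j ∈ I) (i : l) (j : n) : (x * y) i j ∈ I := by
  rw [Matrix.mul_apply]
  exact I.toSubmodule.sum_mem fun s _ => I.mul_mem_left' _ _ (hy s j)

theorem CuntzLE.entries_mem {m n : Type*} [Fintype m] [Fintype n] {a : CStarMatrix m m A}
    {b : CStarMatrix n n A} (h : CuntzLE a b) (hb : ∀ i j, b i j ∈ I) (i j : m) : a i j ∈ I := by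
  have : a i j ∈ closure (I.carrier : Set A) := by
    rw [Metric.mem_closure_iff]
    intro ε hε
    obtain ⟨x, hx⟩ := h ε hε
    refine ⟨(x * b * x.conjTranspose) i j, ?_, ?_⟩
    · exact matrix_mul_mem _ _ (matrix_mul_mem' x b hb) i j
    · rw [dist_eq_norm]
      exact (CStarMatrix.norm_entry_le_norm (M := a - x * b * x.conjTranspose)).trans_lt hx
  rwa [I.isClosed'.closure_eq] at this

namespace PosMat

theorem exists_map_incl {a : PosMat A} (ha : ∀ i j, a.mat i j ∈ I) :
    ∃ b : PosMat I.toStarSubalgebra, b.map I.incl = a :=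
  exists_map_of_injective I.incl Subtype.val_injective fun i j => ⟨⟨_, ha i j⟩, rfl⟩

theorem sub_of_map_incl {a b : PosMat I.toStarSubalgebra}
    (h : (a.map I.incl).Sub (b.map I.incl)) : a.Sub b :=
  sub_of_map_injective I.incl Subtype.val_injective
    (fun d a => ⟨⟨_, I.mul_mem_right' a _ d.2⟩, rfl⟩) h

theorem exists_map_proj (b : PosMat I.Quot) : ∃ a : PosMat A, a.map I.proj = b := by
  obtain ⟨n, b, hb⟩ := b
  obtain ⟨c, rfl⟩ := nonneg_iff.1 hb
  choose d hd using fun i j => ClosedIdeal.mk_surjective (I := I) (c i j)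
  have hd' : CStarMatrix.mapₙₐ (n := Fin n) I.proj (CStarMatrix.ofMatrix d) = c :=
    CStarMatrix.ext hd
  refine ⟨⟨n, star (CStarMatrix.ofMatrix d) * CStarMatrix.ofMatrix d, star_mul_self_nonneg _⟩, ?_⟩
  change PosMat.mk _ _ _ = PosMat.mk _ _ _
  congr 1
  rw [map_mul, map_star, hd']

/-- If `a ≾ b` modulo `I`, then `(a - ε)₊ ≾ b ⊕ d` for some positive matrix `d` over `I`. -/
theorem exists_cutdown_sub_add {a b : PosMat A} (h : (a.map I.proj).Sub (b.map I.proj)) {ε : ℝ}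
    (hε : 0 < ε) : ∃ d : PosMat A, (∀ i j, d.mat i j ∈ I) ∧ (a.cutdown ε).Sub (b + d) := by
  obtain ⟨y, hy⟩ : ∃ y : CStarMatrix (Fin a.size) (Fin b.size) I.Quot, _ := h ε hε
  choose x hx using fun i j => ClosedIdeal.mk_surjective (I := I) (y i j)
  obtain ⟨x, hx⟩ : ∃ x' : CStarMatrix (Fin a.size) (Fin b.size) A, Matrix.map x' I.proj = y :=
    ⟨CStarMatrix.ofMatrix x, CStarMatrix.ext hx⟩
  set π := CStarMatrix.mapₙₐ (n := Fin a.size) I.proj with hπ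
  obtain ⟨z, hz⟩ : ∃ z, z = a.mat - x * b.mat * x.conjTranspose := ⟨_, rfl⟩
  have hc : IsSelfAdjoint (x * b.mat * x.conjTranspose) := isSelfAdjoint_conj x (.of_nonneg b.nonneg)
  have hzs : IsSelfAdjoint z := hz ▸ (IsSelfAdjoint.of_nonneg a.nonneg).sub hc
  have hπz : ‖π z‖ < ε := by
    refine lt_of_le_of_lt (le_of_eq (congrArg _ ?_)) hy
    rw [hz, map_sub, ← hx]
    refine congrArg (fun w => π a.mat - w) ?_
    ext i j
    exact matrix_map_conj I.proj x b.mat i j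
  -- The cutdown at `ε` annihilates the image of `z`, whose norm is below `ε`; hence the entries of
  -- `(z - ε)₊` lie in `I`.
  have h0 : π (DynCuntz.cutdown ε z) = 0 := by
    rw [map_cutdown π hε.le hzs, cutdown_eq_zero (hzs.map π) hπz.le]
  refine ⟨⟨a.size, DynCuntz.cutdown ε z, cutdown_nonneg ε z⟩, fun i j => ?_, ?_⟩
  · have h1 : I.qmk (DynCuntz.cutdown ε z i j) = I.qmk 0 :=
      (congrFun (congrFun h0 i) j).trans (map_zero I.qmk).symm
    have h2 := ClosedIdeal.mk_eq_mk.1 h1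
    rwa [sub_zero] at h2
  · have h1 : CuntzLE (DynCuntz.cutdown ε a.mat)
        (x * b.mat * x.conjTranspose + DynCuntz.cutdown ε z) := by
      -- `z` is only self-adjoint; adding its negative part to `a` leaves the difference `z⁺ - (z -
      -- ε)₊`, of norm at most `ε`.
      obtain ⟨d, hd, h1⟩ := exists_norm_add_sub_cutdown_le hzs hε.le
      refine cutdown_conjLE_of_norm_le a.nonneg
        (hc.add (.of_nonneg (cutdown_nonneg ε z))) hd hε.le ?_
      have e : a.mat + d - (x * b.mat * x.conjTranspose + DynCuntz.cutdown ε z) =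
          z + d - DynCuntz.cutdown ε z := by
        rw [← sub_sub, add_sub_right_comm, ← hz]
      rwa [e]
    exact h1.trans ((cuntzLE_conj_add x b.mat (cutdown_nonneg ε z)).trans
      (PosMat.dsum_cuntzLE_add b ⟨a.size, DynCuntz.cutdown ε z, cutdown_nonneg ε z⟩))

end PosMat

namespace W

/-- Having entries in `I` is invariant under Cuntz equivalence by `CuntzLE.entries_mem`, so the
range can be tested on any representative. -/
theorem mk_mem_range_iff {a : PosMat A} :
    mk a ∈ AddMonoidHom.mrange (W.map I.incl) ↔ ∀ i j, a.mat i j ∈ I := by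
  constructor
  · rintro ⟨x, hx⟩
    obtain ⟨b, rfl⟩ := mk_surjective x
    rw [map_mk, mk_eq_mk] at hx
    exact hx.2.entries_mem fun i j => (b.mat i j).2
  · intro ha
    obtain ⟨b, rfl⟩ := PosMat.exists_map_incl ha
    exact ⟨mk b, rfl⟩

theorem range_incl_isClosedWIdeal :
    IsClosedWIdeal (AddMonoidHom.mrange (W.map I.incl)) where
  mem_of_prec x y h hy := by
    obtain ⟨a, rfl⟩ := mk_surjective x
    obtain ⟨b, rfl⟩ := mk_surjective y
    rw [mk_mem_range_iff] at hy ⊢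
    exact (sub_of_prec h).entries_mem hy
  closed x h := by
    obtain ⟨a, rfl⟩ := mk_surjective x
    rw [mk_mem_range_iff]
    intro i j
    have : a.mat i j ∈ closure (I.carrier : Set A) := by
      rw [Metric.mem_closure_iff]
      intro ε hε
      have h1 := mk_mem_range_iff.1 (h _ (mk_cutdown_prec (half_pos hε) a)) i j
      refine ⟨_, h1, ?_⟩
      rw [dist_eq_norm]
      exact (CStarMatrix.norm_entry_le_norm (M := a.mat - DynCuntz.cutdown (ε / 2) a.mat)).trans_lt
        ((norm_sub_cutdown_le (half_pos hε).le a.nonneg).trans_lt (half_lt_self hε))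
    rwa [I.isClosed'.closure_eq] at this

theorem map_incl_prec_iff (x y : W I.toStarSubalgebra) :
    W.map I.incl x ≺ W.map I.incl y ↔ x ≺ y := by
  refine ⟨fun h => ?_, (map_isWMorphism I.incl).mono x y⟩
  obtain ⟨a, rfl⟩ := mk_surjective x
  obtain ⟨b, rfl⟩ := mk_surjective y
  obtain ⟨δ, hδ, h⟩ := (mk_prec_mk (a := a.map I.incl) (b := b.map I.incl)).1 h
  refine mk_prec_mk.2 ⟨δ, hδ, ?_⟩
  refine PosMat.sub_of_map_incl (b := b.cutdown δ) ?_
  rw [map_cutdown_mk _ hδ.le]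
  exact h

theorem map_proj_surjective : Function.Surjective (W.map I.proj) := by
  intro y
  obtain ⟨b, rfl⟩ := mk_surjective y
  obtain ⟨a, rfl⟩ := PosMat.exists_map_proj b
  exact ⟨mk a, rfl⟩

theorem map_proj_incl (x : W I.toStarSubalgebra) : W.map I.proj (W.map I.incl x) = 0 := by
  obtain ⟨a, rfl⟩ := mk_surjective x
  refine mk_eq_mk.2 ⟨fun ε hε => ⟨0, ?_⟩, sub_of_prec (IsWSemigroup.zero_prec _)⟩
  have e : ((a.map I.incl).map I.proj).mat = 0 := CStarMatrix.ext fun i j =>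
    (ClosedIdeal.mk_eq_mk (I := I) (b := 0)).2 (by rw [sub_zero]; exact (a.mat i j).2)
  rw [e, CStarMatrix.zero_mul, CStarMatrix.zero_mul, sub_zero, norm_zero]
  exact hε

/-- The hypothesis is comparison modulo `I`. Any `z ≺ [a]` is already `≺` the class of some `(a - δ
/ 2)₊`, which lies below `[b] + [d]` with `d` over `I`. -/
theorem idealPreorder_of_map_proj (x y : W A)
    (h : ∀ z, z ≺ W.map I.proj x → z ≺ W.map I.proj y) :
    (idealPreorder (AddMonoidHom.mrange (W.map I.incl))).rel x y := by
  obtain ⟨a, rfl⟩ := mk_surjective x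
  obtain ⟨b, rfl⟩ := mk_surjective y
  have h' : (a.map I.proj).Sub (b.map I.proj) := sub_of_forall_prec h
  intro z hz
  obtain ⟨δ, hδ, hz⟩ := exists_prec_cutdown hz
  obtain ⟨d, hd, hs⟩ := PosMat.exists_cutdown_sub_add h' (half_pos hδ)
  exact ⟨mk d, mk_mem_range_iff.2 hd,
    prec_of_prec_of_sub (hz _ (half_pos hδ) (half_lt_self hδ)) hs⟩

end W

end Ideal

/-! ### Compatibility with the actions, and the theorem -/

section Equivariance

variable {A : Type*} [NonUnitalCStarAlgebra A] {I : ClosedIdeal A} {G : Type*} [Group G]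

theorem W.map_incl_act (α : G →* (A ≃⋆ₐ[ℂ] A)) (hI : I.IsInvariant α) (g : G)
    (x : W I.toStarSubalgebra) :
    W.map I.incl (W.act (I.restrictAction α hI) g x) = W.act α g (W.map I.incl x) := by
  obtain ⟨a, rfl⟩ := W.mk_surjective x
  rfl

theorem W.map_proj_act (α : G →* (A ≃⋆ₐ[ℂ] A)) (hI : I.IsInvariant α) (g : G) (x : W A) :
    W.map I.proj (W.act α g x) = W.act (I.quotAction α hI) g (W.map I.proj x) := by
  obtain ⟨a, rfl⟩ := W.mk_surjective x
  rfl

end Equivariance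

end DynCuntz

theorem mainTheorem4 {G : Type*} [Group G] {A : Type*} [NonUnitalCStarAlgebra A]
    (α : G →* (A ≃⋆ₐ[ℂ] A)) (I : ClosedIdeal A) (hI : I.IsInvariant α) :
    ∃ (_ : IsWSemigroup (WG α)) (_ : IsWSemigroup (WG (I.restrictAction α hI)))
      (_ : IsWSemigroup (WG (I.quotAction α hI)))
      (i : WG (I.restrictAction α hI) →+ WG α) (p : WG α →+ WG (I.quotAction α hI)),
      -- `i` and `p` are the W-morphisms induced by the inclusion and by the quotient map
      (∀ x : W I.toStarSubalgebra, i (MonoidPreorder.proj _ x) =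
        MonoidPreorder.proj _ (W.map I.incl x)) ∧
      (∀ x : W A, p (MonoidPreorder.proj _ x) = MonoidPreorder.proj _ (W.map I.proj x)) ∧
      IsWMorphism i ∧ IsWMorphism p ∧
      -- `i` is an isomorphism onto a closed ideal
      (∀ x y, i x ≤ i y ↔ x ≤ y) ∧ (∀ x y, i x ≺ i y ↔ x ≺ y) ∧
      IsClosedWIdeal (AddMonoidHom.mrange i) ∧
      -- `p` induces an isomorphism from the quotient by that ideal
      (∃ Φ : WIdealQuot (AddMonoidHom.mrange i) ≃+ WG (I.quotAction α hI),
        (∀ x, Φ (MonoidPreorder.proj _ x) = p x) ∧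
        (∀ x y, Φ x ≤ Φ y ↔ x ≤ y) ∧ (∀ x y, Φ x ≺ Φ y ↔ x ≺ y)) ∧
      -- the same for the completions
      IsCuSemigroup (CuG α) ∧ IsCuSemigroup (CuG (I.restrictAction α hI)) ∧
      IsCuSemigroup (CuG (I.quotAction α hI)) ∧
      ∃ j : CuG (I.restrictAction α hI) →+ CuG α,
        (∀ (s : RapidSeq (WG (I.restrictAction α hI))) (t : RapidSeq (WG α)),
          (∀ n, t.1 n = i (s.1 n)) → j (MonoidPreorder.proj _ s) = MonoidPreorder.proj _ t) ∧
        (∀ x y, j x ≤ j y ↔ x ≤ y) ∧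
        IsCuIdeal (AddMonoidHom.mrange j) ∧
        ∃ Ψ : CuIdealQuot (AddMonoidHom.mrange j) ≃+o CuG (I.quotAction α hI),
          ∀ (s : RapidSeq (WG α)) (t : RapidSeq (WG (I.quotAction α hI))),
            (∀ n, t.1 n = p (s.1 n)) →
              Ψ (MonoidPreorder.proj _ (MonoidPreorder.proj _ s)) = MonoidPreorder.proj _ t := by
  have hA := W.act_isWMorphism α
  have hR := W.act_isWMorphism (I.restrictAction α hI)
  have hQ := W.act_isWMorphism (I.quotAction α hI)
  have cA := dynamicalPreorder_isContinuous hA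
  have cR := dynamicalPreorder_isContinuous hR
  have cQ := dynamicalPreorder_isContinuous hQ
  have wA : IsWSemigroup (WG α) := cA.isWSemigroup
  have wR : IsWSemigroup (WG (I.restrictAction α hI)) := cR.isWSemigroup
  have wQ : IsWSemigroup (WG (I.quotAction α hI)) := cQ.isWSemigroup
  have hi := W.map_isWMorphism I.incl
  have hp := W.map_isWMorphism I.proj
  have ei := W.map_incl_act α hI
  have ep := W.map_proj_act α hI
  have hJ : IsClosedWIdeal (AddMonoidHom.mrange (W.map I.incl)) := W.range_incl_isClosedWIdeal
  have hf : ∀ x y, W.map I.incl x ≺ W.map I.incl y ↔ x ≺ y := W.map_incl_prec_iff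
  have hs : Function.Surjective (W.map I.proj) := W.map_proj_surjective
  obtain ⟨i, hi'⟩ : ∃ i, i = DynQuot.map hi ei := ⟨_, rfl⟩
  obtain ⟨p, hp'⟩ : ∃ p, p = DynQuot.map hp ep := ⟨_, rfl⟩
  have wi : IsWMorphism i := hi' ▸ DynQuot.map_isWMorphism hi ei hA
  have wp : IsWMorphism p := hp' ▸ DynQuot.map_isWMorphism hp ep hQ
  have ile : ∀ x y, i x ≤ i y ↔ x ≤ y := hi' ▸ DynQuot.map_le_map_iff hf hi ei hJ
  have iprec : ∀ x y, i x ≺ i y ↔ x ≺ y := hi' ▸ DynQuot.map_prec_map_iff hf hi ei hJ hR hA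
  have iJ : IsClosedWIdeal (AddMonoidHom.mrange i) :=
    hi' ▸ DynQuot.map_range_isClosedWIdeal hf hi ei hJ hA
  have ps : Function.Surjective p := hp' ▸ DynQuot.map_surjective hp ep hs
  have p0 : ∀ x ∈ AddMonoidHom.mrange i, p x = 0 := by
    rintro _ ⟨x, rfl⟩
    obtain ⟨a, rfl⟩ := MonoidPreorder.proj_surjective _ x
    rw [hi', hp']
    exact (congrArg (MonoidPreorder.proj _) (W.map_proj_incl a)).trans (map_zero _)
  -- Both quotient isomorphisms rest on this: `≤_J` for the range of `i` is the pullback of `≤`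
  -- along `p`.
  have prel : ∀ x y, (idealPreorder (AddMonoidHom.mrange i)).rel x y ↔ p x ≤ p y := by
    subst hp'
    refine DynQuot.idealPreorder_rel_iff hA hQ hp ep hs _ W.idealPreorder_of_map_proj _ ?_ p0
    rintro _ ⟨x, rfl⟩
    exact ⟨MonoidPreorder.proj _ x, by rw [hi']; rfl⟩
  have qs := CuCompletion.map_surjective_of_quotient wp ps
    (fun x y h => (prel x y).2 (cQ.le_of_prec h)) p0
  -- `CuCompletion.mem_map_range` identifies the ideal `K` as the elements whose lower sets lie in
  -- the range of `i`.
  have qrel := CuCompletion.cuIdealPreorder_rel_iff wp ps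
    (fun x y h => (prel x y).2 (cQ.le_of_prec h)) p0 iJ fun _ => CuCompletion.mem_map_range iprec iJ
  refine ⟨wA, wR, wQ, i, p, fun x => by rw [hi']; rfl, fun x => by rw [hp']; rfl, wi, wp, ile,
    iprec, iJ, ⟨((idealPreorder (AddMonoidHom.mrange i)).quotEquiv p ps prel).toAddEquiv,
      fun x => rfl, fun x y => map_le_map_iff ((idealPreorder _).quotEquiv p ps prel),
      MonoidPreorder.quotEquiv_prec_iff _ (idealPreorder_isContinuous _ iJ) p ps prel wp
        (fun _ _ => cQ.le_of_prec) fun _ _ _ => cQ.prec_of_le_of_prec⟩,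
    CuCompletion.isCuSemigroup, CuCompletion.isCuSemigroup, CuCompletion.isCuSemigroup,
    CuCompletion.map i fun a b => (iprec a b).2,
    fun s t h => CuCompletion.map_proj_eq _ h, CuCompletion.map_le_map_iff iprec,
    CuCompletion.map_range_isCuIdeal iprec iJ,
    (cuIdealPreorder _).quotEquiv (CuCompletion.map p wp.mono) qs qrel,
    fun s t h => CuCompletion.map_proj_eq wp.mono h⟩
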